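/- \textbf{Setting.} Let $\mathcal{I}$ be a finite poset, let $R=\mathbb{C}\{e_\alpha\mid\alpha\in\mathcal{I}\}$ be the ring spanned by pairwise orthogonal idempotents with sum $1$, let $M$ be a finitely generated $R$-bimodule (on which $\mathbb{C}$ acts centrally), let $W\subset M\otimes_R M$ be a sub-bimodule, and let $A=T_R(M)/\langle W\rangle$, graded by path length. For $\alpha\in\mathcal{I}$ put $\varepsilon_\alpha=\sum_{\gamma\not\le\alpha}e_\gamma$, $P_\alpha=e_\alpha A$, $V_\alpha=e_\alpha A/e_\alpha A\,\varepsilon_\alpha A$ and $L_\alpha=A/(A_+\oplus\mathbb{C}\{e_\beta\mid\beta\ne\alpha\})$ (right modules). Assume that $A$ is \emph{standard Koszul}: $A$ is finite-dimensional; it is quasi-hereditary, i.e. for every $\alpha$ the kernel of $V_\alpha\to L_\alpha$ has a finite filtration with subquotients isomorphic to modules $L_\beta$ with $\beta<\alpha$, and the kernel of $P_\alpha\to V_\alpha$ has a finite filtration with subquotients isomorphic to modules $V_\gamma$ with $\gamma>\alpha$; and every $V_\alpha$, as well as every left standard module $Ae_\alpha/A\,\varepsilon_\alpha Ae_\alpha$,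 has a linear projective resolution (a resolution by graded projective modules, with degree-preserving maps, whose $i$-th term is generated in degree $i$). Let $U$ be a finite-dimensional complex vector space and $S=\operatorname{Sym}U$, with $U$ in degree $2$. Let $\tilde A$ be a flat graded deformation of $A$ over $U^*$: an $\mathbb{N}$-graded $R$-algebra with graded algebra homomorphisms $j\colon S\to\tilde A$ and $\pi\colon\tilde A\to A$ (the latter a map of $R$-algebras) such that $j(S)$ is central, $\pi$ induces an isomorphism $\tilde A/\langle j(U)\rangle\cong A$ of graded algebras, and $\tilde A$ is flat over $S$. Put $\tilde V_\alpha=e_\alpha\tilde A/e_\alpha\tilde A\,\varepsilon_\alpha\tilde A$. \textbf{Theorem.} \begin{enumerate} \item For every $\alpha\in\mathcal{I}$, $\tilde V_\alpha$ is a flat deformation of $V_\alpha$: it is free over $S$, and the map $\tilde V_\alpha\to V_\alpha$ induced by $\pi$ is surjective with kernel $U\tilde V_\alpha$, so that $\tilde V_\alpha\otimes_S\mathbb{C}_0\cong V_\alpha$ as $A$-modules. \item For every $\alpha\in\mathcal{I}$ there is a unique $S$-algebra homomorphism $h_\alpha\colon Z(\tilde A)\to S$ such that $v\cdot\zeta=h_\alpha(\zeta)v$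 for all $v\in\tilde V_\alpha$ and $\zeta\in Z(\tilde A)$. \item The data $(U,Z(\tilde A),\mathcal{I},\bigoplus_\alpha h_\alpha)$ form a localization algebra; that is, $U$ is a finite-dimensional complex vector space, $\mathcal{I}$ is a finite set, $Z(\tilde A)$ is a finitely generated graded $S$-algebra (with the grading induced from $\tilde A$), and $\bigoplus_\alpha h_\alpha\colon Z(\tilde A)\to\bigoplus_{\alpha\in\mathcal{I}}S$ is a homomorphism of $S$-algebras. \end{enumerate} -/

import Mathlib

open scoped DirectSum

noncomputable section

namespace StdKoszul

universe u v w

/-! ### Quadratic algebras over `R = ℂ{e_α | α ∈ I}` -/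

section Quadratic

/-- The ring `R` spanned by pairwise orthogonal idempotents `e_α`, `α ∈ I`, with sum `1`. -/
abbrev VertexRing (I : Type u) : Type u := I → ℂ

variable (I : Type u) (M : Type v) [AddCommGroup M] [Module ℂ M]
  [Module (VertexRing I) M] [Module (VertexRing I)ᵐᵒᵖ M]

/-- The relations that turn the complex tensor algebra on `R ⊕ M` into `T_R(M)`: the map from `R`
is a ring homomorphism and the map from `M` is a map of `R`-bimodules. -/
inductive TensorRel : TensorAlgebra ℂ (VertexRing I × M) → TensorAlgebra ℂ (VertexRing I × M) → Prop
  | one : TensorRel (TensorAlgebra.ι ℂ (1, 0)) 1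
  | mul (r s : VertexRing I) :
      TensorRel (TensorAlgebra.ι ℂ (r * s, 0))
        (TensorAlgebra.ι ℂ (r, 0) * TensorAlgebra.ι ℂ (s, 0))
  | left (r : VertexRing I) (m : M) :
      TensorRel (TensorAlgebra.ι ℂ (0, r • m))
        (TensorAlgebra.ι ℂ (r, 0) * TensorAlgebra.ι ℂ (0, m))
  | right (m : M) (r : VertexRing I) :
      TensorRel (TensorAlgebra.ι ℂ (0, MulOpposite.op r • m))
        (TensorAlgebra.ι ℂ (0, m) * TensorAlgebra.ι ℂ (r, 0))

/-- The tensor algebra `T_R(M)` of the `R`-bimodule `M`. -/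
abbrev BimoduleTensorAlgebra : Type (max u v) := RingQuot (TensorRel I M)

namespace BimoduleTensorAlgebra

/-- The structure map `R → T_R(M)`. -/
def ofR : VertexRing I →ₐ[ℂ] BimoduleTensorAlgebra I M :=
  AlgHom.ofLinearMap
    ((RingQuot.mkAlgHom ℂ (TensorRel I M)).toLinearMap ∘ₗ TensorAlgebra.ι ℂ ∘ₗ
      LinearMap.inl ℂ (VertexRing I) M)
    (by simpa using RingQuot.mkAlgHom_rel ℂ (TensorRel.one (I := I) (M := M)))
    (fun r s => by simpa using RingQuot.mkAlgHom_rel ℂ (TensorRel.mul (M := M) r s))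

/-- The inclusion `M → T_R(M)`. -/
def ofM : M →ₗ[ℂ] BimoduleTensorAlgebra I M :=
  (RingQuot.mkAlgHom ℂ (TensorRel I M)).toLinearMap ∘ₗ TensorAlgebra.ι ℂ ∘ₗ
    LinearMap.inr ℂ (VertexRing I) M

variable {I M}

theorem ofM_smul (r : VertexRing I) (m : M) : ofM I M (r • m) = ofR I M r * ofM I M m := by
  simpa [ofR, ofM] using RingQuot.mkAlgHom_rel ℂ (TensorRel.left r m)

theorem ofM_op_smul (m : M) (r : VertexRing I) :
    ofM I M (MulOpposite.op r • m) = ofM I M m * ofR I M r := by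
  simpa [ofR, ofM] using RingQuot.mkAlgHom_rel ℂ (TensorRel.right m r)

/-- The universal property of `T_R(M)`. -/
def lift {B : Type*} [Semiring B] [Algebra ℂ B] (f : VertexRing I →ₐ[ℂ] B) (g : M →ₗ[ℂ] B)
    (hl : ∀ r m, g (r • m) = f r * g m) (hr : ∀ m r, g (MulOpposite.op r • m) = g m * f r) :
    BimoduleTensorAlgebra I M →ₐ[ℂ] B :=
  RingQuot.liftAlgHom ℂ ⟨TensorAlgebra.lift ℂ (f.toLinearMap.coprod g), fun x y h => by
    cases h <;> simp [hl, hr]⟩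

theorem lift_ofR {B : Type*} [Semiring B] [Algebra ℂ B] (f : VertexRing I →ₐ[ℂ] B) (g : M →ₗ[ℂ] B)
    (hl : ∀ r m, g (r • m) = f r * g m) (hr : ∀ m r, g (MulOpposite.op r • m) = g m * f r)
    (r : VertexRing I) : lift f g hl hr (ofR I M r) = f r := by
  simp [lift, ofR]

theorem lift_ofM {B : Type*} [Semiring B] [Algebra ℂ B] (f : VertexRing I →ₐ[ℂ] B) (g : M →ₗ[ℂ] B)
    (hl : ∀ r m, g (r • m) = f r * g m) (hr : ∀ m r, g (MulOpposite.op r • m) = g m * f r)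
    (m : M) : lift f g hl hr (ofM I M m) = g m := by
  simp [lift, ofM]

theorem algHom_ext {B : Type*} [Semiring B] [Algebra ℂ B]
    {f g : BimoduleTensorAlgebra I M →ₐ[ℂ] B} (hR : ∀ r, f (ofR I M r) = g (ofR I M r))
    (hM : ∀ m, f (ofM I M m) = g (ofM I M m)) : f = g := by
  refine RingQuot.ringQuot_ext' ℂ f g (TensorAlgebra.hom_ext (LinearMap.prod_ext ?_ ?_))
  · ext r : 1
    exact hR r
  · ext m : 1
    exact hM m

end BimoduleTensorAlgebra

open BimoduleTensorAlgebra

/-- A space of quadratic relations: a sub-`R`-bimodule `W` of the degree two part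
`T_R^2(M) = M ⊗_R M` of `T_R(M)`. -/
structure QuadraticRelations where
  /-- The space `W`. -/
  W : Submodule ℂ (BimoduleTensorAlgebra I M)
  le_two : W ≤ LinearMap.range (ofM I M) ^ 2
  mul_left : ∀ (r : VertexRing I), ∀ x ∈ W, ofR I M r * x ∈ W
  mul_right : ∀ (r : VertexRing I), ∀ x ∈ W, x * ofR I M r ∈ W

variable {I M}

namespace QuadraticRelations

/-- The quadratic algebra `A = T_R(M) / ⟨W⟩`. -/
abbrev QAlgebra (W : QuadraticRelations I M) : Type (max u v) :=
  RingQuot fun x y : BimoduleTensorAlgebra I M => x ∈ W.W ∧ y = 0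

variable (W : QuadraticRelations I M)

/-- The quotient map `T_R(M) → A`. -/
def proj : BimoduleTensorAlgebra I M →ₐ[ℂ] W.QAlgebra := RingQuot.mkAlgHom ℂ _

/-- The idempotents `e_α` of `A`. -/
def e [DecidableEq I] (α : I) : W.QAlgebra := W.proj (ofR I M (Pi.single α 1))

/-- The degree zero part of `A`, the image of `R`. -/
def degZero : Submodule ℂ W.QAlgebra := LinearMap.range (W.proj.comp (ofR I M)).toLinearMap

/-- The degree one part of `A`, the image of `M`. -/
def degOne : Submodule ℂ W.QAlgebra := LinearMap.range (W.proj.toLinearMap ∘ₗ ofM I M)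

/-- The grading of `A` by path length: `A_n = R · M ⋯ M` with `n` factors `M`. -/
def grading : ℕ → Submodule ℂ W.QAlgebra
  | 0 => W.degZero
  | n + 1 => grading n * W.degOne

theorem mk_ofR_mem (r : VertexRing I) : W.proj (ofR I M r) ∈ W.grading 0 := ⟨r, rfl⟩

theorem mk_ofM_mem (m : M) : W.proj (ofM I M m) ∈ W.degOne := ⟨m, rfl⟩

theorem one_mem_grading : (1 : W.QAlgebra) ∈ W.grading 0 := ⟨1, by simp⟩

theorem degZero_mul_degZero : W.degZero * W.degZero ≤ W.degZero := by
  rw [Submodule.mul_le]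
  rintro _ ⟨r, rfl⟩ _ ⟨s, rfl⟩
  exact ⟨r * s, by simp⟩

theorem degZero_mul_degOne : W.degZero * W.degOne ≤ W.degOne := by
  rw [Submodule.mul_le]
  rintro _ ⟨r, rfl⟩ _ ⟨m, rfl⟩
  exact ⟨r • m, by simp [ofM_smul]⟩

theorem degOne_mul_degZero : W.degOne * W.degZero ≤ W.degOne := by
  rw [Submodule.mul_le]
  rintro _ ⟨m, rfl⟩ _ ⟨r, rfl⟩
  exact ⟨MulOpposite.op r • m, by simp [ofM_op_smul]⟩

theorem degOne_le_grading : W.degOne ≤ W.grading 1 := fun x hx => by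
  change x ∈ W.grading 0 * W.degOne
  simpa using Submodule.mul_mem_mul (W.one_mem_grading) hx

theorem grading_mul_degZero (n : ℕ) : W.grading n * W.degZero ≤ W.grading n := by
  cases n with
  | zero => exact W.degZero_mul_degZero
  | succ n =>
    change W.grading n * W.degOne * W.degZero ≤ W.grading n * W.degOne
    rw [mul_assoc]
    exact mul_le_mul_right W.degOne_mul_degZero _

theorem grading_mul (m n : ℕ) : W.grading m * W.grading n ≤ W.grading (m + n) := by
  induction n with
  | zero => exact W.grading_mul_degZero m
  | succ n ih =>
    change W.grading m * (W.grading n * W.degOne) ≤ W.grading (m + n) * W.degOne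
    rw [← mul_assoc]
    exact mul_le_mul_left ih _

instance : SetLike.GradedMonoid W.grading where
  one_mem := W.one_mem_grading
  mul_mem _ _ _ _ hx hy := W.grading_mul _ _ (Submodule.mul_mem_mul hx hy)

/-- Auxiliary: `R → ⨁ A_n`. -/
def decR : VertexRing I →ₐ[ℂ] ⨁ n, W.grading n :=
  AlgHom.ofLinearMap
    (DirectSum.lof ℂ ℕ (fun n => W.grading n) 0 ∘ₗ
      ((W.proj.comp (ofR I M)).toLinearMap.codRestrict (W.grading 0) fun r => W.mk_ofR_mem r))
    (by
      rw [DirectSum.one_def]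
      exact congrArg (DirectSum.of (fun n => W.grading n) 0) (Subtype.ext (by simp)))
    (fun r s => by
      simp only [LinearMap.comp_apply, DirectSum.lof_eq_of]
      rw [DirectSum.of_mul_of]
      exact DirectSum.of_eq_of_gradedMonoid_eq (Sigma.subtype_ext rfl
        (map_mul (W.proj.comp (ofR I M)) r s)))

/-- Auxiliary: `M → ⨁ A_n`. -/
def decM : M →ₗ[ℂ] ⨁ n, W.grading n :=
  DirectSum.lof ℂ ℕ (fun n => W.grading n) 1 ∘ₗ
    ((W.proj.toLinearMap ∘ₗ ofM I M).codRestrict (W.grading 1) fun m =>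
      W.degOne_le_grading (W.mk_ofM_mem m))

theorem decR_apply (r : VertexRing I) :
    W.decR r = DirectSum.of (fun n => W.grading n) 0 ⟨W.proj (ofR I M r), W.mk_ofR_mem r⟩ := rfl

theorem decM_apply (m : M) :
    W.decM m = DirectSum.of (fun n => W.grading n) 1
      ⟨W.proj (ofM I M m), W.degOne_le_grading (W.mk_ofM_mem m)⟩ := rfl

/-- Auxiliary: `T_R(M) → ⨁ A_n`. -/
def decT : BimoduleTensorAlgebra I M →ₐ[ℂ] ⨁ n, W.grading n :=
  lift W.decR W.decM
    (fun r m => by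
      rw [decR_apply, decM_apply, decM_apply, DirectSum.of_mul_of]
      exact DirectSum.of_eq_of_gradedMonoid_eq
        (Sigma.subtype_ext rfl
        ((congrArg W.proj (ofM_smul r m)).trans (map_mul W.proj _ _))))
    (fun m r => by
      rw [decR_apply, decM_apply, decM_apply, DirectSum.of_mul_of]
      exact DirectSum.of_eq_of_gradedMonoid_eq
        (Sigma.subtype_ext rfl
        ((congrArg W.proj (ofM_op_smul m r)).trans (map_mul W.proj _ _))))

theorem decT_two (x : BimoduleTensorAlgebra I M) (hx : x ∈ LinearMap.range (ofM I M) ^ 2) :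
    ∃ h : W.proj x ∈ W.grading 2,
      W.decT x = DirectSum.of (fun n => W.grading n) 2 ⟨W.proj x, h⟩ := by
  rw [pow_two] at hx
  induction hx using Submodule.mul_induction_on' with
  | mem_mul_mem a ha b hb =>
    obtain ⟨m, rfl⟩ := ha
    obtain ⟨m', rfl⟩ := hb
    refine ⟨?_, ?_⟩
    · rw [map_mul]
      exact Submodule.mul_mem_mul (W.degOne_le_grading (W.mk_ofM_mem m)) (W.mk_ofM_mem m')
    · rw [map_mul, decT, lift_ofM, lift_ofM, decM_apply, decM_apply, DirectSum.of_mul_of]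
      exact DirectSum.of_eq_of_gradedMonoid_eq (Sigma.subtype_ext rfl
        (map_mul W.proj _ _).symm)
  | add a _ b _ iha ihb =>
    obtain ⟨ha, iha⟩ := iha
    obtain ⟨hb, ihb⟩ := ihb
    refine ⟨by rw [map_add]; exact add_mem ha hb, ?_⟩
    rw [map_add, iha, ihb]
    refine (map_add (DirectSum.of (fun n => W.grading n) 2) ⟨W.proj a, ha⟩ ⟨W.proj b, hb⟩).symm.trans ?_
    exact congrArg (DirectSum.of (fun n => W.grading n) 2) (Subtype.ext (map_add W.proj a b).symm)

/-- Auxiliary: `A → ⨁ A_n`. -/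
def dec : W.QAlgebra →ₐ[ℂ] ⨁ n, W.grading n :=
  RingQuot.liftAlgHom ℂ ⟨W.decT, fun x y h => by
    obtain ⟨hx, rfl⟩ := h
    obtain ⟨h, hd⟩ := W.decT_two x (W.le_two hx)
    have h0 : W.proj x = 0 := by
      have := RingQuot.mkAlgHom_rel ℂ
        (s := fun x y : BimoduleTensorAlgebra I M => x ∈ W.W ∧ y = 0) ⟨hx, rfl⟩
      simpa [proj] using this
    rw [hd, map_zero, (Subtype.ext h0 : (⟨W.proj x, h⟩ : W.grading 2) = 0), map_zero]⟩

theorem dec_mk (x : BimoduleTensorAlgebra I M) : W.dec (W.proj x) = W.decT x := by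
  simp [dec, proj]

/-- `A` is a graded algebra. -/
instance : GradedAlgebra W.grading :=
  GradedAlgebra.ofAlgHom _ W.dec
    (by
      refine RingQuot.ringQuot_ext' ℂ _ _ (algHom_ext (fun r => ?_) (fun m => ?_))
      · change DirectSum.coeAlgHom _ (W.dec (W.proj _)) = W.proj _
        rw [dec_mk, decT, lift_ofR, decR_apply, DirectSum.coeAlgHom_of]
      · change DirectSum.coeAlgHom _ (W.dec (W.proj _)) = W.proj _
        rw [dec_mk, decT, lift_ofM, decM_apply, DirectSum.coeAlgHom_of])
    (fun n => by
      induction n with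
      | zero =>
        rintro ⟨_, r, rfl⟩
        change W.dec (W.proj (ofR I M r)) = _
        rw [dec_mk, decT, lift_ofR, decR_apply]
        rfl
      | succ n ih =>
        rintro ⟨x, hx⟩
        change x ∈ W.grading n * W.degOne at hx
        induction hx using Submodule.mul_induction_on' with
        | mem_mul_mem a ha b hb =>
          obtain ⟨m, rfl⟩ := hb
          change W.dec (a * W.proj (ofM I M m)) = _
          rw [map_mul, ih ⟨a, ha⟩, dec_mk, decT, lift_ofM, decM_apply, DirectSum.of_mul_of]
          exact DirectSum.of_eq_of_gradedMonoid_eq (Sigma.subtype_ext rfl rfl)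
        | add a ha b hb iha ihb =>
          change W.dec (a + b) = _
          rw [map_add]
          erw [iha, ihb]
          rw [← map_add]
          rfl)

end QuadraticRelations

end Quadratic

/-! ### Standard modules and standard Koszul algebras

In this part `A` is a complex algebra with a family of subspaces `𝒜 n` (its grading) and a family
`e` of idempotents indexed by a finite poset `I`. Right `A`-modules are modules over `Aᵐᵒᵖ`. -/

section Standard

variable {I : Type u} [PartialOrder I] {A : Type v} [Ring A]

/-- The right projective module `P_α = e_α A`. -/
def rightProjective (e : I → A) (α : I) : Submodule Aᵐᵒᵖ A := Submodule.span Aᵐᵒᵖ {e α}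

open Classical in
/-- `ε_α`, the sum of all `e_γ` with `γ ≰ α`. -/
def eps [Fintype I] (e : I → A) (α : I) : A := ∑ γ with ¬ γ ≤ α, e γ

/-- The right submodule `e_α A ε_α A` of `A`. -/
def rightTrace [Fintype I] (e : I → A) (α : I) : Submodule Aᵐᵒᵖ A :=
  Submodule.span Aᵐᵒᵖ (Set.range fun a : A => e α * a * eps e α)

/-- The right standard module `V_α = e_α A / e_α A ε_α A`. -/
abbrev RightStandard [Fintype I] (e : I → A) (α : I) : Type v :=
  rightProjective e α ⧸ (rightTrace e α).submoduleOf (rightProjective e α)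

/-- The class in `V_α` of `e_α`. -/
def RightStandard.gen [Fintype I] (e : I → A) (α : I) : RightStandard e α :=
  Submodule.Quotient.mk ⟨e α, Submodule.subset_span rfl⟩

variable [Algebra ℂ A]

/-- The degree `n` part of `V_α`, for the grading induced by that of `A`. -/
def standardGrading [Fintype I] (𝒜 : ℕ → Submodule ℂ A) (e : I → A) (α : I) (n : ℕ) :
    AddSubgroup (RightStandard e α) :=
  ((𝒜 n).toAddSubgroup.comap (rightProjective e α).subtype.toAddMonoidHom).map
    ((rightTrace e α).submoduleOf (rightProjective e α)).mkQ.toAddMonoidHom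

/-- The right ideal `A_+ ⊕ ℂ{e_β | β ≠ α}`, the kernel of `A → L_α`. -/
def simpleIdeal (𝒜 : ℕ → Submodule ℂ A) (e : I → A) (α : I) : Submodule Aᵐᵒᵖ A :=
  Submodule.span Aᵐᵒᵖ ({a | ∃ n, 0 < n ∧ a ∈ 𝒜 n} ∪ {a | ∃ β, β ≠ α ∧ a = e β})

/-- The simple right module `L_α`. -/
abbrev RightSimple (𝒜 : ℕ → Submodule ℂ A) (e : I → A) (α : I) : Type v := A ⧸ simpleIdeal 𝒜 e α

/-- For submodules `K ≤ L` of `N`: the module `L / K` has a finite filtration in which each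
subquotient is isomorphic to one of the modules `Q j` with `p j`. (The members of the filtration
are written as submodules between `K` and `L`.) -/
def HasFiltration {B : Type*} [Ring B] {N : Type*} [AddCommGroup N] [Module B N]
    (K L : Submodule B N) {J : Type*} (p : J → Prop) (Q : J → Type*)
    [∀ j, AddCommGroup (Q j)] [∀ j, Module B (Q j)] : Prop :=
  ∃ (n : ℕ) (F : ℕ → Submodule B N), F 0 = K ∧ F n = L ∧ ∀ i < n, F i ≤ F (i + 1) ∧
    ∃ j, p j ∧ Nonempty ((F (i + 1) ⧸ (F i).submoduleOf (F (i + 1))) ≃ₗ[B] Q j)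

/-- `A` is quasi-hereditary. The kernel of `V_α → L_α` is `(e_α A ∩ (A_+ ⊕ ℂ{e_β | β ≠ α}))`
modulo `e_α A ε_α A`; the kernel of `P_α → V_α` is `e_α A ε_α A`. -/
structure IsQuasiHereditary [Fintype I] (𝒜 : ℕ → Submodule ℂ A) (e : I → A) : Prop where
  ker_standard_simple : ∀ α, HasFiltration (rightTrace e α)
    (rightProjective e α ⊓ simpleIdeal 𝒜 e α) (fun β => β < α) (fun β => RightSimple 𝒜 e β)
  ker_projective_standard : ∀ α, HasFiltration ⊥ (rightTrace e α)
    (fun γ => α < γ) (fun γ => RightStandard e γ)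

/-- A linear projective resolution `⋯ → X 1 → X 0 → N → 0` of a graded right module `N`: an exact
complex of graded projective right modules and degree preserving maps in which `X i` is generated
in degree `i`. (Such an `X i` lives in degrees `≥ i`, so gradings by `ℕ` are enough.) -/
structure LinearProjectiveResolution (𝒜 : ℕ → Submodule ℂ A) (N : Type v) [AddCommGroup N]
    [Module Aᵐᵒᵖ N] (𝒩 : ℕ → AddSubgroup N) where
  /-- The terms of the resolution. -/
  X : ℕ → Type v
  [addCommGroup : ∀ i, AddCommGroup (X i)]
  [module : ∀ i, Module Aᵐᵒᵖ (X i)]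
  /-- The grading of each term. -/
  deg : ∀ i, ℕ → AddSubgroup (X i)
  isInternal : ∀ i, DirectSum.IsInternal (deg i)
  smul_mem : ∀ i m n (a : A) (x : X i), a ∈ 𝒜 m → x ∈ deg i n → MulOpposite.op a • x ∈ deg i (n + m)
  projective : ∀ i, Module.Projective Aᵐᵒᵖ (X i)
  generated : ∀ i, Submodule.span Aᵐᵒᵖ (deg i i : Set (X i)) = ⊤
  /-- The differentials. -/
  d : ∀ i, X (i + 1) →ₗ[Aᵐᵒᵖ] X i
  d_mem : ∀ i n, ∀ x ∈ deg (i + 1) n, d i x ∈ deg i n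
  /-- The augmentation. -/
  aug : X 0 →ₗ[Aᵐᵒᵖ] N
  aug_mem : ∀ n, ∀ x ∈ deg 0 n, aug x ∈ 𝒩 n
  aug_surjective : Function.Surjective aug
  exact_zero : Function.Exact (d 0) aug
  exact_succ : ∀ i, Function.Exact (d (i + 1)) (d i)

/-- The grading of the opposite algebra. -/
def opGrading (𝒜 : ℕ → Submodule ℂ A) (n : ℕ) : Submodule ℂ Aᵐᵒᵖ :=
  (𝒜 n).map (MulOpposite.opLinearEquiv ℂ).toLinearMap

/-- `A` is standard Koszul: finite dimensional and quasi-hereditary, and all right and left standard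
modules have linear projective resolutions. Left `A`-modules are treated as right modules over the
opposite algebra. -/
structure IsStandardKoszul [Fintype I] (𝒜 : ℕ → Submodule ℂ A) (e : I → A) : Prop where
  finiteDimensional : FiniteDimensional ℂ A
  quasiHereditary : IsQuasiHereditary 𝒜 e
  right : ∀ α, Nonempty (LinearProjectiveResolution 𝒜 (RightStandard e α) (standardGrading 𝒜 e α))
  left : ∀ α, Nonempty (LinearProjectiveResolution (opGrading 𝒜)
    (RightStandard (fun β => MulOpposite.op (e β)) α)
    (standardGrading (opGrading 𝒜) (fun β => MulOpposite.op (e β)) α))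

end Standard

/-! ### Deformations and localization algebras over `S = Sym U` -/

section Deformation

variable (U : Type w) [AddCommGroup U] [Module ℂ U]

/-- `π : A' → A` exhibits the graded algebra `A'` over `S = Sym U` (`U` in degree two) as a graded
deformation of `A` over `U^*`. The family `e'` is the `R`-algebra structure of `A'`, the structure
map `j : S → A'` has central image as `A'` is an `S`-algebra, and `j` is graded as soon as
`j(U)` has degree two. -/
structure IsGradedDeformation {I : Type*} [Fintype I] {A : Type*} [Ring A] [Algebra ℂ A]
    (𝒜 : ℕ → Submodule ℂ A) (e : I → A)
    {A' : Type*} [Ring A'] [Algebra ℂ A'] [Algebra (SymmetricAlgebra ℂ U) A']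
    (𝒜' : ℕ → Submodule ℂ A') (e' : I → A') (π : A' →ₐ[ℂ] A) : Prop where
  idempotents : CompleteOrthogonalIdempotents e'
  idempotent_mem : ∀ α, e' α ∈ 𝒜' 0
  map_idempotent : ∀ α, π (e' α) = e α
  parameter_mem : ∀ u : U,
    algebraMap (SymmetricAlgebra ℂ U) A' (SymmetricAlgebra.ι ℂ U u) ∈ 𝒜' 2
  map_mem : ∀ n, ∀ a ∈ 𝒜' n, π a ∈ 𝒜 n
  surjective : Function.Surjective π
  map_eq_zero_iff : ∀ a, π a = 0 ↔ a ∈ TwoSidedIdeal.span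
    (Set.range fun u : U => algebraMap (SymmetricAlgebra ℂ U) A' (SymmetricAlgebra.ι ℂ U u))

/-- The data `(U, Z, I, h)` form a localization algebra. Here `𝒵` is the grading of `Z`,
and elements of `U` have degree two. -/
structure IsLocalizationAlgebra {Z : Type*} [CommRing Z] [Algebra ℂ Z]
    [Algebra (SymmetricAlgebra ℂ U) Z] [IsScalarTower ℂ (SymmetricAlgebra ℂ U) Z]
    (𝒵 : ℕ → Submodule ℂ Z) (I : Type*)
    (h : Z →ₐ[SymmetricAlgebra ℂ U] (I → SymmetricAlgebra ℂ U)) : Prop where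
  finiteDimensional : FiniteDimensional ℂ U
  finite : Finite I
  graded : Nonempty (GradedAlgebra 𝒵)
  parameter_mem : ∀ u : U,
    algebraMap (SymmetricAlgebra ℂ U) Z (SymmetricAlgebra.ι ℂ U u) ∈ 𝒵 2
  finiteType : Algebra.FiniteType (SymmetricAlgebra ℂ U) Z

variable {U} {A' : Type*} [Ring A'] [Algebra ℂ A'] [Algebra (SymmetricAlgebra ℂ U) A']
  [IsScalarTower ℂ (SymmetricAlgebra ℂ U) A']

/-- The grading of the center of `A'` induced by that of `A'`. -/
def centerGrading (𝒜' : ℕ → Submodule ℂ A') (n : ℕ) :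
    Submodule ℂ (Subalgebra.center (SymmetricAlgebra ℂ U) A') :=
  (𝒜' n).comap
    ((Subalgebra.center (SymmetricAlgebra ℂ U) A').val.restrictScalars ℂ).toLinearMap

/-- The family `h` describes the action of the center on the modules `V'_α`:
`v · ζ = h_α(ζ) v`. -/
def IsCentralCharacter {I : Type*} [Fintype I] [PartialOrder I] (e' : I → A')
    (h : I → (Subalgebra.center (SymmetricAlgebra ℂ U) A' →ₐ[SymmetricAlgebra ℂ U]
      SymmetricAlgebra ℂ U)) : Prop :=
  ∀ (α : I) (v : RightStandard e' α) (ζ : Subalgebra.center (SymmetricAlgebra ℂ U) A'),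
    MulOpposite.op (ζ : A') • v = h α ζ • v

/-- `V'_α = e'_α A' / e'_α A' ε'_α A'` is a flat deformation of `V_α` along `π : A' → A`: it is free
over `S = Sym U`, and the map `V'_α → V_α` induced by `π` is a well-defined surjective map of modules
along `π` with kernel `S_+ V'_α = U V'_α`, that is, it identifies `V'_α ⊗_S ℂ_0` with `V_α`. -/
def IsFlatDeformationOfStandard {I : Type*} [Fintype I] [PartialOrder I]
    {A : Type*} [Ring A] [Algebra ℂ A] (e : I → A) (e' : I → A') (π : A' →ₐ[ℂ] A) (α : I) : Prop :=
  Module.Free (SymmetricAlgebra ℂ U) (RightStandard e' α) ∧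
    ∃ p : RightStandard e' α →ₛₗ[RingHom.op (π : A' →+* A)] RightStandard e α,
      p (RightStandard.gen e' α) = RightStandard.gen e α ∧
      Function.Surjective p ∧
      ∀ v, p v = 0 ↔ v ∈ (Ideal.span (Set.range (SymmetricAlgebra.ι ℂ U)) •
        (⊤ : Submodule (SymmetricAlgebra ℂ U) (RightStandard e' α)))

end Deformation

end StdKoszul

end

open StdKoszul

/-! Write `S_+` for the ideal of `S` generated by `U`. Since `j(U)` is central, `ker π = S_+ A'`.
The heart of the proof is that the trace `K' = e'_α A' ε'_α A'` meets this kernel only in `S_+ K'`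
(`rightTrace_inf_ker`): no relation of `V'_α` becomes invisible in `V_α`.

This holds by inspection for elements of `K'` fixed by `ε'_α` on the right, since `e'_α (S_+ A')
ε'_α = S_+ (e'_α A' ε'_α)` (`mul_eps_mem_augIdeal_smul`). To reach all of `K'`, the filtration of
`e_α A ε_α A` by modules `V_γ`, `γ > α`, is lifted to a chain between `S_+ K'` and `K'`
(`exists_lift_filtration`). The generator of each step lifts to some `g' = g' e'_γ`, and the
relations of `V_γ` must hold for `g'` modulo the previous term. They are generated by elements
ending in `ε'_γ`, and `ε'_γ ε'_α = ε'_γ` for `γ ≥ α`, so the corner case applies to them. The last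
term of the chain contains the generators of `K'`, by the corner case again.

Freeness is then a Nakayama argument. Homogeneous lifts of a basis of `A` adapted to the images of
`K' ⊆ e'_α A'` generate `K'`, `e'_α A'` and `A'`, by the graded Nakayama lemma
`le_of_le_sup_augIdeal_smul`. In particular `A'` is finite over the noetherian domain `S`; being
flat it is projective, and `linearIndependent_of_relations_mem` makes the lifts a basis. So `K'` has
a free complement in `e'_α A'`, isomorphic to `V'_α`.

For the central characters, the kernel of `V_α → L_α` involves only `L_β` with `β < α`, on which
`e_α` acts by zero; hence `e_α A e_α ⊆ ℂ e_α + e_α A ε_α A`. By Nakayama `e'_α A' e'_α ⊆ S e'_α +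
K'` (`exists_smul_gen`), so a central element multiplies the generator of `V'_α` by an element of
`S`, unique because `V'_α` is free and the generator is nonzero. Finally, the center is an
`S`-submodule of the noetherian module `A'`, and it contains the homogeneous components of its
elements. -/

namespace StdKoszul

open DirectSum

/-! ### Generating families of projective modules -/

/-- A finite generating family of a projective module over a domain is independent if all its
relations have coefficients in a fixed proper ideal. -/
theorem linearIndependent_of_relations_mem {R : Type*} [CommRing R] [IsDomain R] {m : Ideal R}
    (hm : m ≠ ⊤) {N : Type*} [AddCommGroup N] [Module R N] [Module.Projective R N]
    {ι : Type*} [Fintype ι] (b : ι → N) (hb : Submodule.span R (Set.range b) = ⊤)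
    (h : ∀ c : ι → R, ∑ i, c i • b i = 0 → ∀ i, c i ∈ m) : LinearIndependent R b := by
  classical
  set f : (ι → R) →ₗ[R] N := Fintype.linearCombination R b with hf
  have hsurj : Function.Surjective f := by
    rw [← LinearMap.range_eq_top, hf, Fintype.range_linearCombination, hb]
  obtain ⟨g, hg⟩ := Module.projective_lifting_property f LinearMap.id hsurj
  have hfg (x : N) : f (g x) = x := LinearMap.congr_fun hg x
  let ρ : (ι → R) →ₗ[R] (ι → R) := LinearMap.id - g ∘ₗ f
  have hρ (x) : f (ρ x) = 0 := by simp [ρ, hfg]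
  have hρ' (x) (hx : f x = 0) : ρ x = x := by simp [ρ, hx]
  have hker : LinearMap.ker f = LinearMap.range ρ := by
    ext x
    exact ⟨fun hx => ⟨x, hρ' x hx⟩, by rintro ⟨y, rfl⟩; exact hρ y⟩
  have hle : LinearMap.ker f ≤ m • LinearMap.ker f := by
    intro x hx
    have hx' : ∀ i, x i ∈ m := h x (by simpa [hf, Fintype.linearCombination_apply] using hx)
    -- `ρ` projects onto the kernel, so a relation `x` equals the sum of the `x i • ρ (e_i)`, with
    -- `x i ∈ m` and `ρ (e_i)` itself a relation.
    rw [← hρ' x hx, pi_eq_sum_univ' x, map_sum]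
    refine Submodule.sum_mem _ fun i _ => ?_
    rw [map_smul]
    exact Submodule.smul_mem_smul (hx' i) (hρ _)
  -- Nakayama in the form with `r ≡ 1` modulo `m`. Such an `r` is nonzero since `m` is proper, and a
  -- nonzero scalar kills no nonzero vector of `ι → R` over a domain. No locality is needed.
  obtain ⟨r, hr, hr0⟩ := Submodule.exists_sub_one_mem_and_smul_eq_zero_of_fg_of_le_smul m
    (LinearMap.ker f) (by rw [hker, LinearMap.range_eq_map]; exact Module.Finite.fg_top.map ρ) hle
  have hrne : r ≠ 0 := by
    rintro rfl
    exact hm ((Ideal.eq_top_iff_one m).mpr (by simpa using hr))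
  rw [Fintype.linearIndependent_iff]
  intro c hc i
  have := congrFun (hr0 c (by simpa [hf, Fintype.linearCombination_apply] using hc)) i
  simpa [hrne] using this

/-! ### The augmentation of `S = Sym U` -/

section Sym

variable (U : Type*) [AddCommGroup U] [Module ℂ U]

/-- The ideal of `S = Sym U` generated by `U`. -/
abbrev augIdeal : Ideal (SymmetricAlgebra ℂ U) := Ideal.span (Set.range (SymmetricAlgebra.ι ℂ U))

variable {U}

theorem sub_algebraMapInv_mem (s : SymmetricAlgebra ℂ U) :
    s - algebraMap ℂ _ (SymmetricAlgebra.algebraMapInv s) ∈ augIdeal U := by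
  induction s using SymmetricAlgebra.induction with
  | algebraMap r => simp
  | ι x =>
    rw [SymmetricAlgebra.algebraMapInv_ι, map_zero, sub_zero]
    exact Ideal.subset_span ⟨x, rfl⟩
  | mul a b ha hb =>
    have := add_mem (Ideal.mul_mem_right b _ ha)
      (Ideal.mul_mem_left _ (algebraMap ℂ _ (SymmetricAlgebra.algebraMapInv a)) hb)
    convert this using 1
    simp only [map_mul]
    ring
  | add a b ha hb =>
    convert add_mem ha hb using 1
    simp only [map_add]
    ring

theorem mem_augIdeal_iff (s : SymmetricAlgebra ℂ U) :
    s ∈ augIdeal U ↔ SymmetricAlgebra.algebraMapInv s = 0 := by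
  refine ⟨fun hs => ?_, fun hs => by simpa [hs] using sub_algebraMapInv_mem s⟩
  have : augIdeal U ≤ RingHom.ker (SymmetricAlgebra.algebraMapInv (R := ℂ) (M := U)) := by
    rw [Ideal.span_le]
    rintro _ ⟨u, rfl⟩
    exact SymmetricAlgebra.algebraMapInv_ι u
  exact this hs

theorem augIdeal_ne_top : augIdeal U ≠ ⊤ := by
  rw [Ne, Ideal.eq_top_iff_one, mem_augIdeal_iff]
  simp

instance [FiniteDimensional ℂ U] : IsNoetherianRing (SymmetricAlgebra ℂ U) :=
  isNoetherianRing_of_ringEquiv _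
    (SymmetricAlgebra.equivMvPolynomial (Module.finBasis ℂ U)).symm.toRingEquiv

end Sym

/-! ### Homogeneous submodules over `S` -/

section Homogeneous

variable {U : Type*} [AddCommGroup U] [Module ℂ U]
  {A' : Type*} [Ring A'] [Algebra ℂ A'] [Algebra (SymmetricAlgebra ℂ U) A']
  [IsScalarTower ℂ (SymmetricAlgebra ℂ U) A'] (𝒜' : ℕ → Submodule ℂ A') [GradedAlgebra 𝒜']

/-- `H` contains the homogeneous components of its elements. -/
def HasComponents (H : Submodule (SymmetricAlgebra ℂ U) A') : Prop :=
  ∀ x ∈ H, ∀ n, (decompose 𝒜' x n : A') ∈ H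

variable {𝒜'}

/-- The element `x` is quantified after the scalar so that the product case of the induction on `s`
can apply one hypothesis to the outcome of the other. -/
theorem component_smul_mem
    (hpar : ∀ u : U, algebraMap (SymmetricAlgebra ℂ U) A' (SymmetricAlgebra.ι ℂ U u) ∈ 𝒜' 2)
    {H : Submodule (SymmetricAlgebra ℂ U) A'} (s : SymmetricAlgebra ℂ U) :
    ∀ x : A', (∀ n, (decompose 𝒜' x n : A') ∈ H) → ∀ n, (decompose 𝒜' (s • x) n : A') ∈ H := by
  induction s using SymmetricAlgebra.induction with
  | algebraMap r =>
    intro x hx n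
    rw [algebraMap_smul, decompose_smul]
    exact (H.restrictScalars ℂ).smul_mem r (hx n)
  | ι u =>
    intro x hx n
    rw [Algebra.smul_def, coe_decompose_mul_of_left_mem 𝒜' n (hpar u)]
    split_ifs
    · rw [← Algebra.smul_def]
      exact H.smul_mem _ (hx _)
    · exact H.zero_mem
  | mul a b ha hb =>
    intro x hx
    rw [mul_smul]
    exact ha _ (hb x hx)
  | add a b ha hb =>
    intro x hx n
    rw [add_smul, decompose_add]
    exact H.add_mem (ha x hx n) (hb x hx n)

theorem hasComponents_span
    (hpar : ∀ u : U, algebraMap (SymmetricAlgebra ℂ U) A' (SymmetricAlgebra.ι ℂ U u) ∈ 𝒜' 2)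
    {b : Set A'} (hb : ∀ x ∈ b, ∃ n, x ∈ 𝒜' n) :
    HasComponents 𝒜' (Submodule.span (SymmetricAlgebra ℂ U) b) := by
  intro x hx
  induction hx using Submodule.span_induction with
  | mem x hx =>
    intro n
    obtain ⟨k, hk⟩ := hb x hx
    by_cases hkn : k = n
    · subst hkn
      rw [decompose_of_mem_same 𝒜' hk]
      exact Submodule.subset_span hx
    · rw [decompose_of_mem_ne 𝒜' hk hkn]
      exact zero_mem _
  | zero => intro n; simp
  | add x y _ _ hx hy =>
    intro n
    rw [decompose_add]
    exact add_mem (hx n) (hy n)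
  | smul s x _ hx => exact component_smul_mem hpar s x hx

-- Multiplication by `u ∈ U` raises the degree by two, so the component of `u • y` in degree `n`
-- only involves that of `y` in degree `n - 2`. This is the inductive step of the graded Nakayama
-- lemma.
omit [IsScalarTower ℂ (SymmetricAlgebra ℂ U) A'] in
theorem component_mem_of_mem_augIdeal_smul
    (hpar : ∀ u : U, algebraMap (SymmetricAlgebra ℂ U) A' (SymmetricAlgebra.ι ℂ U u) ∈ 𝒜' 2)
    {H Q : Submodule (SymmetricAlgebra ℂ U) A'} {n : ℕ}
    (hn : ∀ k < n, ∀ y ∈ H, (decompose 𝒜' y k : A') ∈ Q) (x : A') (hx : x ∈ augIdeal U • H) :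
    (decompose 𝒜' x n : A') ∈ Q := by
  induction hx using Submodule.smul_induction_on' with
  | add x _ y _ hx hy =>
    rw [decompose_add]
    exact add_mem hx hy
  | smul s hs y hy =>
    induction hs using Submodule.span_induction generalizing y with
    | mem s hs =>
      obtain ⟨u, rfl⟩ := hs
      rw [Algebra.smul_def, coe_decompose_mul_of_left_mem 𝒜' n (hpar u)]
      split_ifs with h
      · rw [← Algebra.smul_def]
        exact Q.smul_mem _ (hn _ (by omega) y hy)
      · exact Q.zero_mem
    | zero => simp
    | add s t _ _ hs ht =>
      rw [add_smul, decompose_add]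
      exact add_mem (hs y hy) (ht y hy)
    | smul t s _ hs =>
      rw [smul_eq_mul, mul_comm, mul_smul]
      exact hs _ (H.smul_mem t hy)

omit [IsScalarTower ℂ (SymmetricAlgebra ℂ U) A'] in
/-- An element of a graded module lies in a submodule that contains its components. -/
theorem mem_of_components_mem (Q : Submodule (SymmetricAlgebra ℂ U) A') (x : A')
    (h : ∀ n, (decompose 𝒜' x n : A') ∈ Q) : x ∈ Q := by
  classical
  rw [← sum_support_decompose 𝒜' x]
  exact Submodule.sum_mem _ fun n _ => h n

omit [IsScalarTower ℂ (SymmetricAlgebra ℂ U) A'] in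
/-- The graded Nakayama lemma. -/
theorem le_of_le_sup_augIdeal_smul
    (hpar : ∀ u : U, algebraMap (SymmetricAlgebra ℂ U) A' (SymmetricAlgebra.ι ℂ U u) ∈ 𝒜' 2)
    {H Q : Submodule (SymmetricAlgebra ℂ U) A'} (hQ : HasComponents 𝒜' Q)
    (h : H ≤ Q ⊔ augIdeal U • H) : H ≤ Q := by
  -- Degrees are bounded below by zero, so strong induction on the degree replaces finite
  -- generation. Only `Q` has to be homogeneous, not `H`.
  suffices key : ∀ n, ∀ x ∈ H, (decompose 𝒜' x n : A') ∈ Q from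
    fun x hx => mem_of_components_mem Q x fun n => key n x hx
  intro n
  induction n using Nat.strong_induction_on with
  | _ n ih =>
    intro x hx
    obtain ⟨q, hq, y, hy, rfl⟩ := Submodule.mem_sup.mp (h hx)
    rw [decompose_add]
    exact add_mem (hQ q hq n) (component_mem_of_mem_augIdeal_smul hpar ih y hy)

end Homogeneous

/-! ### Graded deformations -/

namespace IsGradedDeformation

variable {U : Type*} [AddCommGroup U] [Module ℂ U] {I : Type*} [Fintype I]
  {A : Type*} [Ring A] [Algebra ℂ A] {𝒜 : ℕ → Submodule ℂ A} {e : I → A}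
  {A' : Type*} [Ring A'] [Algebra ℂ A'] [Algebra (SymmetricAlgebra ℂ U) A']
  [IsScalarTower ℂ (SymmetricAlgebra ℂ U) A'] {𝒜' : ℕ → Submodule ℂ A'} [GradedAlgebra 𝒜']
  {e' : I → A'} {π : A' →ₐ[ℂ] A}

omit [GradedAlgebra 𝒜'] in
theorem map_smul (hdef : IsGradedDeformation U 𝒜 e 𝒜' e' π) (s : SymmetricAlgebra ℂ U) (a : A') :
    π (s • a) = SymmetricAlgebra.algebraMapInv s • π a := by
  induction s using SymmetricAlgebra.induction generalizing a with
  | algebraMap r => simp [algebraMap_smul]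
  | ι u =>
    have : π (algebraMap _ A' (SymmetricAlgebra.ι ℂ U u)) = 0 :=
      (hdef.map_eq_zero_iff _).mpr (TwoSidedIdeal.subset_span ⟨u, rfl⟩)
    rw [Algebra.smul_def, map_mul, this, zero_mul, SymmetricAlgebra.algebraMapInv_ι, zero_smul]
  | mul a b ha hb => rw [mul_smul, ha, hb, map_mul, mul_smul]
  | add a b ha hb => rw [add_smul, map_add, ha, hb, map_add, add_smul]

-- Since `S` acts centrally, the two-sided ideal generated by `U` is just `S_+ A'`; conversely `π`
-- factors the action of `S` through the augmentation.
omit [GradedAlgebra 𝒜'] in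
theorem map_eq_zero_iff_mem_smul (hdef : IsGradedDeformation U 𝒜 e 𝒜' e' π) (a : A') :
    π a = 0 ↔ a ∈ augIdeal U • (⊤ : Submodule (SymmetricAlgebra ℂ U) A') := by
  constructor
  · intro ha
    have hmul (b x c : A') (hx : x ∈ augIdeal U • (⊤ : Submodule (SymmetricAlgebra ℂ U) A')) :
        b * x * c ∈ augIdeal U • (⊤ : Submodule (SymmetricAlgebra ℂ U) A') := by
      induction hx using Submodule.smul_induction_on' with
      | add x _ y _ hx hy =>
        rw [mul_add, add_mul]
        exact add_mem hx hy
      | smul s hs y _ =>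
        rw [mul_smul_comm, smul_mul_assoc]
        exact Submodule.smul_mem_smul hs trivial
    suffices H : ∀ x ∈ TwoSidedIdeal.span (Set.range fun u : U =>
        algebraMap (SymmetricAlgebra ℂ U) A' (SymmetricAlgebra.ι ℂ U u)),
        x ∈ augIdeal U • (⊤ : Submodule (SymmetricAlgebra ℂ U) A') from
      H a ((hdef.map_eq_zero_iff a).mp ha)
    intro x hx
    induction hx using TwoSidedIdeal.span_induction with
    | mem x hx =>
      obtain ⟨u, rfl⟩ := hx
      simp only [Algebra.algebraMap_eq_smul_one]
      exact Submodule.smul_mem_smul (Ideal.subset_span ⟨u, rfl⟩) trivial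
    | zero => exact zero_mem _
    | add x y _ _ hx hy => exact add_mem hx hy
    | neg x _ hx => exact neg_mem hx
    | left_absorb b x _ hx => simpa using hmul b x 1 hx
    | right_absorb b x _ hx => simpa using hmul 1 x b hx
  · intro ha
    induction ha using Submodule.smul_induction_on' with
    | add x _ y _ hx hy => rw [map_add, hx, hy, add_zero]
    | smul s hs y _ => rw [hdef.map_smul, (mem_augIdeal_iff s).mp hs, zero_smul]

/-- Homogeneous elements of `H` whose images span the image of `H` generate `H`, if
`H ∩ ker π = U H`. -/
theorem span_eq (hdef : IsGradedDeformation U 𝒜 e 𝒜' e' π)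
    {H : Submodule (SymmetricAlgebra ℂ U) A'} (hH : HasComponents 𝒜' H)
    (hker : ∀ x ∈ H, π x = 0 → x ∈ augIdeal U • H) {b : Set A'}
    (hb : b ⊆ {x | x ∈ H ∧ ∃ n, x ∈ 𝒜' n})
    (hspan : π '' {x | x ∈ H ∧ ∃ n, x ∈ 𝒜' n} ⊆ Submodule.span ℂ (π '' b)) :
    Submodule.span (SymmetricAlgebra ℂ U) b = H := by
  have hbH : Submodule.span (SymmetricAlgebra ℂ U) b ≤ H :=
    Submodule.span_le.mpr fun x hx => (hb hx).1
  refine le_antisymm hbH (le_of_le_sup_augIdeal_smul hdef.parameter_mem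
    (hasComponents_span hdef.parameter_mem fun x hx => (hb hx).2) fun x hx => ?_)
  refine mem_of_components_mem (𝒜' := 𝒜') _ x fun n => ?_
  have hy : (decompose 𝒜' x n : A') ∈ H := hH x hx n
  have hyn : (decompose 𝒜' x n : A') ∈ 𝒜' n := (decompose 𝒜' x n).2
  generalize (decompose 𝒜' x n : A') = y at hy hyn
  have hπ : π y ∈ Submodule.map π.toLinearMap (Submodule.span ℂ b) := by
    rw [Submodule.map_span]
    exact hspan ⟨y, ⟨hy, n, hyn⟩, rfl⟩
  obtain ⟨z, hz, hzy⟩ := hπ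
  have hz' : z ∈ Submodule.span (SymmetricAlgebra ℂ U) b :=
    Submodule.span_le_restrictScalars ℂ (SymmetricAlgebra ℂ U) b hz
  rw [← add_sub_cancel z y]
  -- The difference of `y` and its approximation `z` lies in `H ∩ ker π`, hence in `S_+ H`.
  refine add_mem (Submodule.mem_sup_left hz') (Submodule.mem_sup_right (hker _
    (sub_mem hy (hbH hz')) ?_))
  rw [map_sub, sub_eq_zero]
  exact hzy.symm

/-- A homogeneous basis adapted to a chain of two homogeneous submodules. -/
theorem exists_adapted_family [FiniteDimensional ℂ A] (hdef : IsGradedDeformation U 𝒜 e 𝒜' e' π)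
    {K H : Submodule (SymmetricAlgebra ℂ U) A'} (hKH : K ≤ H)
    (hK : HasComponents 𝒜' K) (hH : HasComponents 𝒜' H)
    (hKker : ∀ x ∈ K, π x = 0 → x ∈ augIdeal U • K)
    (hHker : ∀ x ∈ H, π x = 0 → x ∈ augIdeal U • H) :
    ∃ b₁ b₂ b₃ : Set A', b₁ ⊆ b₂ ∧ b₂ ⊆ b₃ ∧ b₃.Finite ∧ LinearIndepOn ℂ π b₃ ∧
      Submodule.span (SymmetricAlgebra ℂ U) b₁ = K ∧ Submodule.span (SymmetricAlgebra ℂ U) b₂ = H ∧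
      Submodule.span (SymmetricAlgebra ℂ U) b₃ = ⊤ := by
  -- Three successive maximal extensions among homogeneous elements of `K`, of `H` and of `A'`,
  -- keeping the images under `π` independent over `ℂ`.
  obtain ⟨b₁, hb₁, -, hs₁, hi₁⟩ := exists_linearIndepOn_extension (K := ℂ) (v := π)
    (linearIndepOn_empty ℂ π) (Set.empty_subset {x | x ∈ K ∧ ∃ n, x ∈ 𝒜' n})
  obtain ⟨b₂, hb₂, h₁₂, hs₂, hi₂⟩ := exists_linearIndepOn_extension (K := ℂ) (v := π)
    hi₁ (t := {x | x ∈ H ∧ ∃ n, x ∈ 𝒜' n}) (hb₁.trans fun x hx => ⟨hKH hx.1, hx.2⟩)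
  obtain ⟨b₃, hb₃, h₂₃, hs₃, hi₃⟩ := exists_linearIndepOn_extension (K := ℂ) (v := π)
    hi₂ (t := {x | x ∈ (⊤ : Submodule (SymmetricAlgebra ℂ U) A') ∧ ∃ n, x ∈ 𝒜' n})
    (hb₂.trans fun x hx => ⟨trivial, hx.2⟩)
  exact ⟨b₁, b₂, b₃, h₁₂, h₂₃, Set.finite_coe_iff.mp (LinearIndependent.finite hi₃), hi₃,
    hdef.span_eq hK hKker hb₁ hs₁, hdef.span_eq hH hHker hb₂ hs₂,
    hdef.span_eq (H := ⊤) (fun _ _ _ => trivial)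
      (fun x _ => (hdef.map_eq_zero_iff_mem_smul x).mp) hb₃ hs₃⟩

theorem moduleFinite [FiniteDimensional ℂ A] (hdef : IsGradedDeformation U 𝒜 e 𝒜' e' π) :
    Module.Finite (SymmetricAlgebra ℂ U) A' := by
  obtain ⟨-, -, b, -, -, hfin, -, -, -, hs⟩ := hdef.exists_adapted_family
    (le_refl (⊤ : Submodule (SymmetricAlgebra ℂ U) A')) (fun _ _ _ => trivial)
    (fun _ _ _ => trivial) (fun x _ => (hdef.map_eq_zero_iff_mem_smul x).mp)
    (fun x _ => (hdef.map_eq_zero_iff_mem_smul x).mp)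
  exact ⟨⟨hfin.toFinset, by simpa using hs⟩⟩

/-- Over a flat graded deformation, homogeneous submodules `K ≤ H` with `K ∩ ker π = U K` and
`H ∩ ker π = U H` have a free quotient `H / K`, which is a direct summand of `H`. -/
theorem exists_free_complement [FiniteDimensional ℂ U] [FiniteDimensional ℂ A]
    (hdef : IsGradedDeformation U 𝒜 e 𝒜' e' π) (hflat : Module.Flat (SymmetricAlgebra ℂ U) A')
    {K H : Submodule (SymmetricAlgebra ℂ U) A'} (hKH : K ≤ H)
    (hK : HasComponents 𝒜' K) (hH : HasComponents 𝒜' H)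
    (hKker : ∀ x ∈ K, π x = 0 → x ∈ augIdeal U • K)
    (hHker : ∀ x ∈ H, π x = 0 → x ∈ augIdeal U • H) :
    ∃ F : Submodule (SymmetricAlgebra ℂ U) A', Module.Free (SymmetricAlgebra ℂ U) F ∧
      Disjoint K F ∧ K ⊔ F = H := by
  obtain ⟨b₁, b₂, b₃, h₁₂, h₂₃, hfin, hind, hs₁, hs₂, hs₃⟩ :=
    hdef.exists_adapted_family hKH hK hH hKker hHker
  have := hdef.moduleFinite
  have : Module.FinitePresentation (SymmetricAlgebra ℂ U) A' :=
    Module.finitePresentation_of_finite _ _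
  have : Module.Projective (SymmetricAlgebra ℂ U) A' :=
    Module.Flat.projective_of_finitePresentation
  have := hfin.fintype
  -- Applying `π` to an `S`-linear relation gives a complex relation between independent vectors, so
  -- its coefficients have augmentation zero.
  have hli : LinearIndepOn (SymmetricAlgebra ℂ U) id b₃ := by
    refine linearIndependent_of_relations_mem augIdeal_ne_top (fun x : b₃ => (x : A'))
      (by simpa using hs₃) fun c hc i => ?_
    rw [mem_augIdeal_iff]
    have h0 := congrArg π hc
    simp only [map_sum, hdef.map_smul, map_zero] at h0
    exact Fintype.linearIndependent_iff.mp hind _ h0 i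
  refine ⟨Submodule.span (SymmetricAlgebra ℂ U) (b₂ \ b₁), ?_, ?_, ?_⟩
  · have : LinearIndepOn (SymmetricAlgebra ℂ U) id (b₂ \ b₁) :=
      hli.mono (Set.sdiff_subset.trans h₂₃)
    have h := Module.Free.of_basis (Module.Basis.span this)
    rwa [show Set.range (fun x : ↑(b₂ \ b₁) => id (x : A')) = b₂ \ b₁ from
      Subtype.range_coe] at h
  · rw [← hs₁]
    have := hli.disjoint_span_image (s := Subtype.val ⁻¹' b₁) (t := Subtype.val ⁻¹' (b₂ \ b₁))
      (Disjoint.preimage _ Set.disjoint_sdiff_right)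
    have hval (s : Set A') (hs : s ⊆ b₃) :
        (fun x : b₃ => id (x : A')) '' (Subtype.val ⁻¹' s) = s := by
      simpa using hs
    rwa [hval _ (h₁₂.trans h₂₃), hval _ (Set.sdiff_subset.trans h₂₃)] at this
  · rw [← hs₁, ← hs₂, ← Submodule.span_union, Set.union_sdiff_cancel h₁₂]

end IsGradedDeformation

/-! ### Right ideals and standard modules -/

section RightIdeals

variable {I : Type*} {A : Type*} [Ring A] {e : I → A}

theorem mul_mem_of_mem {K : Submodule Aᵐᵒᵖ A} {x : A} (hx : x ∈ K) (a : A) : x * a ∈ K :=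
  K.smul_mem (MulOpposite.op a) hx

theorem mem_rightProjective (α : I) (h : IsIdempotentElem (e α)) (x : A) :
    x ∈ rightProjective e α ↔ e α * x = x := by
  rw [rightProjective, Submodule.mem_span_singleton]
  constructor
  · rintro ⟨a, rfl⟩
    rw [MulOpposite.smul_eq_mul_unop, ← mul_assoc, h.eq]
  · intro hx
    exact ⟨MulOpposite.op x, hx⟩

variable [PartialOrder I] [Fintype I]

theorem mul_mul_eps_mem_rightTrace (α : I) (a : A) : e α * a * eps e α ∈ rightTrace e α :=
  Submodule.subset_span ⟨a, rfl⟩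

theorem rightTrace_le_rightProjective (α : I) : rightTrace e α ≤ rightProjective e α := by
  refine Submodule.span_le.mpr ?_
  rintro _ ⟨a, rfl⟩
  simp only [mul_assoc]
  exact mul_mem_of_mem (Submodule.mem_span_singleton_self (e α)) _

/-- Every `δ ≰ γ` also satisfies `δ ≰ α`, so each summand of `ε_γ` occurs in `ε_α`. -/
theorem mul_eps_mul_eps (he : OrthogonalIdempotents e) {α γ : I} (h : α ≤ γ) :
    eps e γ * eps e α = eps e γ := by
  classical
  rw [eps, Finset.sum_mul]
  refine Finset.sum_congr rfl fun δ hδ => ?_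
  have hδ' : ¬ δ ≤ γ := by simpa using hδ
  rw [eps, Finset.mul_sum, Finset.sum_eq_single δ]
  · exact (he.idem δ).eq
  · intro β _ hβ
    exact he.ortho hβ.symm
  · intro hδα
    have : δ ≤ α := by simpa using hδα
    exact absurd (this.trans h) hδ'

theorem RightStandard.op_smul_gen_eq_zero_iff (α : I) (a : A) :
    MulOpposite.op a • RightStandard.gen e α = 0 ↔ e α * a ∈ rightTrace e α :=
  Submodule.Quotient.mk_eq_zero _

theorem RightStandard.exists_op_smul_gen (α : I) (v : RightStandard e α) :
    ∃ a : A, v = MulOpposite.op a • RightStandard.gen e α := by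
  obtain ⟨⟨x, hx⟩, rfl⟩ := Submodule.Quotient.mk_surjective _ v
  obtain ⟨a, rfl⟩ := Submodule.mem_span_singleton.mp hx
  exact ⟨a.unop, rfl⟩

/-- If `L / K ≅ V_γ`, then `L = K + g A` for some `g = g e_γ` such that the annihilator of `g`
modulo `K` is that of the generator of `V_γ`. -/
theorem exists_generator_of_equiv (he : OrthogonalIdempotents e) {K L : Submodule Aᵐᵒᵖ A} {γ : I}
    (φ : (L ⧸ K.submoduleOf L) ≃ₗ[Aᵐᵒᵖ] RightStandard e γ) :
    ∃ g ∈ L, g * e γ = g ∧ (∀ a, g * a ∈ K ↔ e γ * a ∈ rightTrace e γ) ∧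
      ∀ y ∈ L, ∃ a, y - g * a ∈ K := by
  obtain ⟨⟨g, hg⟩, hgφ⟩ := Submodule.Quotient.mk_surjective _ (φ.symm (RightStandard.gen e γ))
  have key (a : A) : g * a ∈ K ↔ e γ * a ∈ rightTrace e γ := by
    rw [← RightStandard.op_smul_gen_eq_zero_iff, ← φ.symm.map_eq_zero_iff, map_smul, ← hgφ,
      ← Submodule.Quotient.mk_smul, Submodule.Quotient.mk_eq_zero]
    rfl
  -- The generator of `V_γ` is fixed by `e_γ`, so replacing `g` by `g e_γ` changes it only modulo
  -- `K`.
  refine ⟨g * e γ, mul_mem_of_mem hg _, by rw [mul_assoc, (he.idem γ).eq], fun a => ?_, ?_⟩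
  · rw [mul_assoc, key, ← mul_assoc, (he.idem γ).eq]
  · intro y hy
    obtain ⟨a, ha⟩ := RightStandard.exists_op_smul_gen γ (φ (Submodule.Quotient.mk ⟨y, hy⟩))
    refine ⟨a, ?_⟩
    have h1 : y - g * a ∈ K := by
      have := congrArg φ.symm ha
      rw [φ.symm_apply_apply, map_smul, ← hgφ, ← Submodule.Quotient.mk_smul,
        Submodule.Quotient.eq] at this
      exact this
    have h2 : g * ((1 - e γ) * a) ∈ K := by
      rw [key, ← mul_assoc, mul_sub, mul_one, (he.idem γ).eq, sub_self, zero_mul]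
      exact zero_mem _
    convert add_mem h1 h2 using 1
    noncomm_ring

end RightIdeals

/-! ### The trace submodule of a graded deformation -/

section SMul

variable {U : Type*} [AddCommGroup U] [Module ℂ U]
  {A' : Type*} [Ring A'] [Algebra (SymmetricAlgebra ℂ U) A']

/-- Coefficients in `S` are central and pull out of the product. This is how `ker π = S_+ A'` is cut
down to corners such as `e'_α A' ε'_α`. -/
theorem mulLeft_mulRight_mem_augIdeal_smul (a b : A') {H K : Submodule (SymmetricAlgebra ℂ U) A'}
    (h : ∀ y ∈ H, a * y * b ∈ K) {x : A'} (hx : x ∈ augIdeal U • H) :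
    a * x * b ∈ augIdeal U • K := by
  induction hx using Submodule.smul_induction_on' with
  | add x _ y _ hx hy =>
    rw [mul_add, add_mul]
    exact add_mem hx hy
  | smul s hs y hy =>
    rw [mul_smul_comm, smul_mul_assoc]
    exact Submodule.smul_mem_smul hs (h y hy)

end SMul

namespace IsGradedDeformation

variable {U : Type*} [AddCommGroup U] [Module ℂ U] {I : Type*} [Fintype I] [PartialOrder I]
  {A : Type*} [Ring A] [Algebra ℂ A] {𝒜 : ℕ → Submodule ℂ A} {e : I → A}
  {A' : Type*} [Ring A'] [Algebra ℂ A'] [Algebra (SymmetricAlgebra ℂ U) A']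
  [IsScalarTower ℂ (SymmetricAlgebra ℂ U) A'] {𝒜' : ℕ → Submodule ℂ A'}
  {e' : I → A'} {π : A' →ₐ[ℂ] A}

omit [IsScalarTower ℂ (SymmetricAlgebra ℂ U) A'] [PartialOrder I] in
theorem orthogonalIdempotents (hdef : IsGradedDeformation U 𝒜 e 𝒜' e' π) :
    OrthogonalIdempotents e := by
  have := hdef.idempotents.toOrthogonalIdempotents.map (f := (π : A' →+* A))
  rwa [show ⇑(π : A' →+* A) ∘ e' = e from funext hdef.map_idempotent] at this

omit [IsScalarTower ℂ (SymmetricAlgebra ℂ U) A'] in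
theorem map_eps (hdef : IsGradedDeformation U 𝒜 e 𝒜' e' π) (α : I) : π (eps e' α) = eps e α := by
  simp [eps, hdef.map_idempotent]

omit [IsScalarTower ℂ (SymmetricAlgebra ℂ U) A'] in
theorem map_mem_rightTrace (hdef : IsGradedDeformation U 𝒜 e 𝒜' e' π) {α : I} {x : A'}
    (hx : x ∈ rightTrace e' α) : π x ∈ rightTrace e α := by
  induction hx using Submodule.span_induction with
  | mem x hx =>
    obtain ⟨a, rfl⟩ := hx
    simpa [hdef.map_idempotent, hdef.map_eps] using mul_mul_eps_mem_rightTrace α (π a)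
  | zero => simp
  | add x y _ _ hx hy => rw [map_add]; exact add_mem hx hy
  | smul a x _ hx =>
    rw [MulOpposite.smul_eq_mul_unop, map_mul]
    exact mul_mem_of_mem hx _

omit [IsScalarTower ℂ (SymmetricAlgebra ℂ U) A'] in
theorem exists_mem_rightTrace (hdef : IsGradedDeformation U 𝒜 e 𝒜' e' π) {α : I} {x : A}
    (hx : x ∈ rightTrace e α) : ∃ x' ∈ rightTrace e' α, π x' = x := by
  induction hx using Submodule.span_induction with
  | mem x hx =>
    obtain ⟨a, rfl⟩ := hx
    obtain ⟨a, rfl⟩ := hdef.surjective a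
    exact ⟨_, mul_mul_eps_mem_rightTrace α a, by simp [hdef.map_idempotent, hdef.map_eps]⟩
  | zero => exact ⟨0, zero_mem _, map_zero π⟩
  | add x y _ _ hx hy =>
    obtain ⟨x, hx, rfl⟩ := hx
    obtain ⟨y, hy, rfl⟩ := hy
    exact ⟨x + y, add_mem hx hy, map_add π x y⟩
  | smul a x _ hx =>
    obtain ⟨x, hx, rfl⟩ := hx
    obtain ⟨b, hb⟩ := hdef.surjective a.unop
    exact ⟨x * b, mul_mem_of_mem hx b, by rw [map_mul, hb]; rfl⟩

/-- Here `x = e'_α x ε'_α`, and sandwiching an element of `S_+ A'` in this way lands in `S_+ (e'_α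
A' ε'_α)`, inside `S_+` times the trace. -/
theorem mul_eps_mem_augIdeal_smul (hdef : IsGradedDeformation U 𝒜 e 𝒜' e' π) {α : I} {x : A'}
    (hx : x ∈ rightTrace e' α) (hε : x * eps e' α = x) (hπ : π x = 0) :
    x ∈ augIdeal U • (rightTrace e' α).restrictScalars (SymmetricAlgebra ℂ U) := by
  have he : e' α * x = x :=
    (mem_rightProjective α (hdef.idempotents.idem α) x).mp (rightTrace_le_rightProjective α hx)
  have h := mulLeft_mulRight_mem_augIdeal_smul (e' α) (eps e' α)
    (K := (rightTrace e' α).restrictScalars (SymmetricAlgebra ℂ U))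
    (fun y _ => mul_mul_eps_mem_rightTrace α y) ((hdef.map_eq_zero_iff_mem_smul x).mp hπ)
  rwa [he, hε] at h

/-- The annihilator of the class of `g` in a standard module lifts to `A'`. -/
theorem mul_mem_of_lift (hdef : IsGradedDeformation U 𝒜 e 𝒜' e' π) {α γ : I} (hγ : α < γ)
    {F : Submodule Aᵐᵒᵖ A} {g : A} (hann : ∀ a, g * a ∈ F ↔ e γ * a ∈ rightTrace e γ)
    {G : Submodule A'ᵐᵒᵖ A'} (hGK : G ≤ rightTrace e' α)
    (hmG : ∀ x ∈ augIdeal U • (rightTrace e' α).restrictScalars (SymmetricAlgebra ℂ U), x ∈ G)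
    (hGF : ∀ y ∈ F, ∃ x ∈ G, π x = y) {g' : A'} (hg' : g' ∈ rightTrace e' α)
    (hg'e : g' * e' γ = g') (hπg' : π g' = g) (a : A') (ha : π (g' * a) ∈ F) : g' * a ∈ G := by
  have hoe' := hdef.idempotents.toOrthogonalIdempotents
  have hεεα : eps e' γ * eps e' α = eps e' γ := mul_eps_mul_eps hoe' hγ.le
  have hεε : eps e' γ * eps e' γ = eps e' γ := mul_eps_mul_eps hoe' le_rfl
  -- The image lies in `F`, so it lifts to some `y ∈ G`. After right multiplication by `ε'_γ` the
  -- difference is fixed by `ε'_α` and killed by `π`, so the corner case puts it in `S_+` times the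
  -- trace, hence in `G`.
  have hgε (b : A') : g' * b * eps e' γ ∈ G := by
    have hFb : π (g' * b * eps e' γ) ∈ F := by
      rw [map_mul, map_mul, hπg', hdef.map_eps, mul_assoc, hann, ← mul_assoc]
      exact mul_mul_eps_mem_rightTrace γ _
    obtain ⟨y, hy, hyπ⟩ := hGF _ hFb
    have hyG : y * eps e' γ ∈ G := mul_mem_of_mem hy _
    have h := hdef.mul_eps_mem_augIdeal_smul (x := g' * b * eps e' γ - y * eps e' γ)
      (sub_mem (mul_mem_of_mem (mul_mem_of_mem hg' _) _) (hGK hyG))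
      (by rw [sub_mul, mul_assoc, hεεα, mul_assoc y, hεεα])
      (by rw [map_sub, map_mul π y, hyπ, ← map_mul, mul_assoc (g' * b), hεε, sub_self])
    simpa using add_mem (hmG _ h) hyG
  have hgt (t : A') (ht : t ∈ rightTrace e' γ) : g' * t ∈ G := by
    induction ht using Submodule.span_induction with
    | mem t ht =>
      obtain ⟨b, rfl⟩ := ht
      simpa only [← mul_assoc, hg'e] using hgε b
    | zero => simp
    | add x y _ _ hx hy => rw [mul_add]; exact add_mem hx hy
    | smul a x _ hx =>
      rw [MulOpposite.smul_eq_mul_unop, ← mul_assoc]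
      exact mul_mem_of_mem hx _
  -- Now `e'_γ a` splits as an element `t` of the trace for `γ` plus an element of `ker π`; the
  -- factor `g'` sends the first into `G` and the second into `S_+` times the trace for `α`.
  rw [map_mul, hπg', hann] at ha
  obtain ⟨t, ht, hta⟩ := hdef.exists_mem_rightTrace ha
  have h0 : π (e' γ * a - t) = 0 := by
    rw [map_sub, map_mul, hdef.map_idempotent, hta, sub_self]
  have h := mulLeft_mulRight_mem_augIdeal_smul g' 1 (K := (rightTrace e' α).restrictScalars (SymmetricAlgebra ℂ U))
    (fun y _ => by
      rw [mul_one]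
      exact mul_mem_of_mem hg' y)
    ((hdef.map_eq_zero_iff_mem_smul _).mp h0)
  rw [mul_one, mul_sub, ← mul_assoc, hg'e] at h
  simpa using add_mem (hmG _ h) (hgt t ht)

/-- Lifting the steps of a standard filtration of `e_α A ε_α A` to `e'_α A' ε'_α A'`. -/
theorem exists_lift_filtration (hdef : IsGradedDeformation U 𝒜 e 𝒜' e' π) {α : I}
    {n : ℕ} {F : ℕ → Submodule Aᵐᵒᵖ A} (hF0 : F 0 = ⊥) (hFn : F n = rightTrace e α)
    (hF : ∀ i < n, F i ≤ F (i + 1) ∧ ∃ γ, α < γ ∧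
      Nonempty ((F (i + 1) ⧸ (F i).submoduleOf (F (i + 1))) ≃ₗ[Aᵐᵒᵖ] RightStandard e γ))
    (i : ℕ) (hi : i ≤ n) :
    ∃ G : Submodule A'ᵐᵒᵖ A', G ≤ rightTrace e' α ∧
      (∀ x ∈ augIdeal U • (rightTrace e' α).restrictScalars (SymmetricAlgebra ℂ U), x ∈ G) ∧
      (∀ y ∈ F i, ∃ x ∈ G, π x = y) ∧ (∀ x ∈ G, π x ∈ F i) ∧
      ∀ x ∈ G, π x = 0 →
        x ∈ augIdeal U • (rightTrace e' α).restrictScalars (SymmetricAlgebra ℂ U) := by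
  set K' := (rightTrace e' α).restrictScalars (SymmetricAlgebra ℂ U) with hK'
  have hle : augIdeal U • K' ≤ K' := Submodule.smul_le_right
  have hright (x : A') (hx : x ∈ augIdeal U • K') (a : A') : x * a ∈ augIdeal U • K' := by
    simpa using mulLeft_mulRight_mem_augIdeal_smul 1 a (K := K')
      (fun y hy => by
        rw [one_mul]
        exact mul_mem_of_mem (K := rightTrace e' α) hy a) hx
  have hoe := hdef.orthogonalIdempotents
  have hoe' := hdef.idempotents.toOrthogonalIdempotents
  induction i with
  | zero =>
    -- The chain starts at `S_+ K'` itself, which `π` maps to zero.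
    refine ⟨{ (augIdeal U • K').toAddSubmonoid with
      smul_mem' := fun a x hx => hright x hx a.unop }, fun x hx => hle hx, fun x hx => hx, ?_, ?_,
      fun x hx _ => hx⟩
    rotate_left
    · intro x hx
      rw [(hdef.map_eq_zero_iff_mem_smul x).mpr (Submodule.smul_mono le_rfl le_top hx)]
      exact zero_mem _
    intro y hy
    rw [hF0, Submodule.mem_bot] at hy
    exact ⟨0, zero_mem _, by rw [hy, map_zero]⟩
  | succ i ih =>
    obtain ⟨G, hGK, hmG, hGF, hFG, hGker⟩ := ih (by omega)
    obtain ⟨hFi, γ, hγ, ⟨φ⟩⟩ := hF i (by omega)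
    obtain ⟨g, hg, hge, hann, hgen⟩ := exists_generator_of_equiv hoe φ
    have hmono : ∀ j ≤ n, i + 1 ≤ j → F (i + 1) ≤ F j := by
      intro j hj hij
      induction j, hij using Nat.le_induction with
      | base => exact le_rfl
      | succ j _ ih => exact (ih (by omega)).trans (hF j (by omega)).1
    obtain ⟨g₀, hg₀, hg₀g⟩ := hdef.exists_mem_rightTrace (hFn ▸ hmono n le_rfl hi hg)
    set g' := g₀ * e' γ with hg'def
    have hg' : g' ∈ rightTrace e' α := mul_mem_of_mem hg₀ _
    have hπg' : π g' = g := by rw [map_mul, hg₀g, hdef.map_idempotent, hge]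
    have hg'e : g' * e' γ = g' := by rw [hg'def, mul_assoc, (hoe'.idem γ).eq]
    have hga (a : A') (ha : π (g' * a) ∈ F i) : g' * a ∈ G :=
      hdef.mul_mem_of_lift hγ hann hGK hmG hGF hg' hg'e hπg' a ha
    have hg'G : g' ∈ G ⊔ Submodule.span A'ᵐᵒᵖ {g'} :=
      Submodule.mem_sup_right (Submodule.mem_span_singleton_self g')
    refine ⟨G ⊔ Submodule.span A'ᵐᵒᵖ {g'}, sup_le hGK (by simpa using hg'),
      fun x hx => Submodule.mem_sup_left (hmG x hx), ?_, ?_, ?_⟩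
    · intro y hy
      obtain ⟨a, ha⟩ := hgen y hy
      obtain ⟨a, rfl⟩ := hdef.surjective a
      obtain ⟨x, hx, hxπ⟩ := hGF _ ha
      refine ⟨x + g' * a, add_mem (Submodule.mem_sup_left hx) (mul_mem_of_mem hg'G a), ?_⟩
      rw [map_add, map_mul, hxπ, hπg', sub_add_cancel]
    · intro x hx
      obtain ⟨y, hy, z, hz, rfl⟩ := Submodule.mem_sup.mp hx
      obtain ⟨a, rfl⟩ := Submodule.mem_span_singleton.mp hz
      rw [map_add, MulOpposite.smul_eq_mul_unop, map_mul, hπg']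
      exact add_mem (hFi (hFG y hy)) (mul_mem_of_mem hg _)
    · intro x hx hx0
      refine hGker x ?_ hx0
      obtain ⟨y, hy, z, hz, rfl⟩ := Submodule.mem_sup.mp hx
      obtain ⟨a, rfl⟩ := Submodule.mem_span_singleton.mp hz
      -- If `y + g' a` is killed by `π`, then `π (g' a) = -π y` lies in `F i`, so the new generator
      -- contributes nothing outside `G`.
      refine add_mem hy (hga a.unop ?_)
      rw [map_add, add_eq_zero_iff_neg_eq] at hx0
      exact hx0 ▸ neg_mem (hFG y hy)

/-- If `e_α A ε_α A` has a standard filtration, `e'_α A' ε'_α A' ∩ ker π = U e'_α A' ε'_α A'`. -/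
theorem rightTrace_inf_ker (hdef : IsGradedDeformation U 𝒜 e 𝒜' e' π) {α : I}
    (hα : HasFiltration ⊥ (rightTrace e α) (fun γ => α < γ) (fun γ => RightStandard e γ))
    {x : A'} (hx : x ∈ rightTrace e' α) (hπ : π x = 0) :
    x ∈ augIdeal U • (rightTrace e' α).restrictScalars (SymmetricAlgebra ℂ U) := by
  obtain ⟨n, F, hF0, hFn, hF⟩ := hα
  obtain ⟨G, hGK, hmG, hGF, -, hGker⟩ := hdef.exists_lift_filtration hF0 hFn hF n le_rfl
  refine hGker x ?_ hπ
  -- Surjectivity onto the image alone would only give the trace up to `ker π`; the corner case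
  -- removes this ambiguity on the generators `e'_α a ε'_α`.
  suffices rightTrace e' α ≤ G from this hx
  refine Submodule.span_le.mpr ?_
  rintro _ ⟨a, rfl⟩
  have hεε := mul_eps_mul_eps hdef.idempotents.toOrthogonalIdempotents (le_refl α)
  have ha := mul_mul_eps_mem_rightTrace (e := e') α a
  obtain ⟨y, hy, hyπ⟩ := hGF _ (hFn ▸ hdef.map_mem_rightTrace ha)
  have hyG : y * eps e' α ∈ G := mul_mem_of_mem hy _
  have h := hdef.mul_eps_mem_augIdeal_smul (x := e' α * a * eps e' α - y * eps e' α)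
    (sub_mem ha (hGK hyG)) (by rw [sub_mul, mul_assoc, hεε, mul_assoc y, hεε])
    (by rw [map_sub, map_mul π y, hyπ, ← map_mul, mul_assoc (e' α * a), hεε, sub_self])
  simpa using add_mem (hmG _ h) hyG

end IsGradedDeformation

/-! ### Homogeneity of right ideals -/

section RightIdeals

variable {A' : Type*} [Ring A'] [Algebra ℂ A'] {𝒜' : ℕ → Submodule ℂ A'} [GradedAlgebra 𝒜']
  {I : Type*} [Fintype I] {e' : I → A'}

theorem component_mul_mem {K : Submodule A'ᵐᵒᵖ A'} {x : A'}
    (hx : ∀ n, (decompose 𝒜' x n : A') ∈ K) (a : A') (n : ℕ) :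
    (decompose 𝒜' (x * a) n : A') ∈ K := by
  induction a using Decomposition.inductionOn 𝒜' with
  | zero => simp
  | @homogeneous i a =>
    rw [coe_decompose_mul_of_right_mem 𝒜' n a.2]
    split_ifs
    · exact mul_mem_of_mem (hx _) _
    · exact zero_mem _
  | add a b ha hb =>
    rw [mul_add, decompose_add]
    exact add_mem ha hb

omit [Fintype I] in
theorem component_mem_rightProjective (he : ∀ α, e' α ∈ 𝒜' 0) {α : I} {x : A'}
    (hx : x ∈ rightProjective e' α) (n : ℕ) :
    (decompose 𝒜' x n : A') ∈ rightProjective e' α := by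
  obtain ⟨a, rfl⟩ := Submodule.mem_span_singleton.mp hx
  refine component_mul_mem (fun n => ?_) a.unop n
  rw [← mul_one (e' α), coe_decompose_mul_of_left_mem_zero 𝒜' (he α)]
  exact mul_mem_of_mem (Submodule.mem_span_singleton_self _) _

variable [PartialOrder I]

theorem component_mem_rightTrace (he : ∀ α, e' α ∈ 𝒜' 0) {α : I} {x : A'}
    (hx : x ∈ rightTrace e' α) (n : ℕ) :
    (decompose 𝒜' x n : A') ∈ rightTrace e' α := by
  have hε : eps e' α ∈ 𝒜' 0 := Submodule.sum_mem _ fun β _ => he β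
  induction hx using Submodule.span_induction generalizing n with
  | mem x hx =>
    obtain ⟨a, rfl⟩ := hx
    simp only
    rw [coe_decompose_mul_of_right_mem_zero 𝒜' hε, coe_decompose_mul_of_left_mem_zero 𝒜' (he α)]
    exact mul_mul_eps_mem_rightTrace α _
  | zero => simp
  | add x y _ _ hx hy =>
    rw [decompose_add]
    exact add_mem (hx n) (hy n)
  | smul a x _ hx => exact component_mul_mem hx a.unop n

end RightIdeals

/-! ### Standard modules of a graded deformation -/

section ToStandard

variable {U : Type*} [AddCommGroup U] [Module ℂ U] {I : Type*} [Fintype I] [PartialOrder I]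
  {A' : Type*} [Ring A'] [Algebra (SymmetricAlgebra ℂ U) A']

variable (U) in
/-- The map `A' → V'_α`, `a ↦ e'_α a`. -/
def toStandard (e' : I → A') (α : I) : A' →ₗ[SymmetricAlgebra ℂ U] RightStandard e' α where
  toFun x := MulOpposite.op x • RightStandard.gen e' α
  map_add' x y := by rw [MulOpposite.op_add, add_smul]
  map_smul' s x := by rw [MulOpposite.op_smul, smul_assoc, RingHom.id_apply]

theorem toStandard_apply (e' : I → A') (α : I) (x : A') :
    toStandard U e' α x = MulOpposite.op x • RightStandard.gen e' α := rfl

theorem toStandard_surjective (e' : I → A') (α : I) :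
    Function.Surjective (toStandard U e' α) := fun v => by
  obtain ⟨a, rfl⟩ := RightStandard.exists_op_smul_gen α v
  exact ⟨a, rfl⟩

theorem toStandard_eq_zero_iff (e' : I → A') (α : I) (x : A') :
    toStandard U e' α x = 0 ↔ e' α * x ∈ rightTrace e' α :=
  RightStandard.op_smul_gen_eq_zero_iff α x

end ToStandard

namespace IsGradedDeformation

variable {U : Type*} [AddCommGroup U] [Module ℂ U] {I : Type*} [Fintype I] [PartialOrder I]
  {A : Type*} [Ring A] [Algebra ℂ A] {𝒜 : ℕ → Submodule ℂ A} {e : I → A}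
  {A' : Type*} [Ring A'] [Algebra ℂ A'] [Algebra (SymmetricAlgebra ℂ U) A']
  [IsScalarTower ℂ (SymmetricAlgebra ℂ U) A'] {𝒜' : ℕ → Submodule ℂ A'}
  {e' : I → A'} {π : A' →ₐ[ℂ] A}

theorem free_rightStandard [GradedAlgebra 𝒜'] [FiniteDimensional ℂ U] [FiniteDimensional ℂ A]
    (hdef : IsGradedDeformation U 𝒜 e 𝒜' e' π) (hflat : Module.Flat (SymmetricAlgebra ℂ U) A')
    {α : I}
    (hα : HasFiltration ⊥ (rightTrace e α) (fun γ => α < γ) (fun γ => RightStandard e γ)) :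
    Module.Free (SymmetricAlgebra ℂ U) (RightStandard e' α) := by
  have hP (x : A') := mem_rightProjective α (hdef.idempotents.idem α) x
  obtain ⟨F, hF, hdisj, hsup⟩ := hdef.exists_free_complement hflat
    (K := (rightTrace e' α).restrictScalars (SymmetricAlgebra ℂ U))
    (H := (rightProjective e' α).restrictScalars (SymmetricAlgebra ℂ U))
    (rightTrace_le_rightProjective α)
    (fun x hx n => component_mem_rightTrace hdef.idempotent_mem hx n)
    (fun x hx n => component_mem_rightProjective hdef.idempotent_mem hx n)
    (fun x hx => hdef.rightTrace_inf_ker hα hx)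
    (fun x hx h0 => by
      have h := mulLeft_mulRight_mem_augIdeal_smul (e' α) 1
        (K := (rightProjective e' α).restrictScalars (SymmetricAlgebra ℂ U))
        (fun y _ => by
          rw [mul_one]
          exact mul_mem_of_mem (Submodule.mem_span_singleton_self (e' α)) y)
        ((hdef.map_eq_zero_iff_mem_smul x).mp h0)
      rwa [mul_one, (hP x).mp hx] at h)
  have hFP {x : A'} (hx : x ∈ F) : e' α * x = x :=
    (hP x).mp (show x ∈ (rightProjective e' α).restrictScalars (SymmetricAlgebra ℂ U) from
      hsup ▸ Submodule.mem_sup_right hx)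
  -- The free complement of the trace in `e'_α A'` maps isomorphically onto the quotient `V'_α`.
  refine Module.Free.of_equiv (LinearEquiv.ofBijective (toStandard U e' α ∘ₗ F.subtype) ⟨?_, ?_⟩)
  · rw [injective_iff_map_eq_zero]
    intro x hx
    have h : e' α * (x : A') ∈ rightTrace e' α :=
      (toStandard_eq_zero_iff (U := U) e' α x).mp hx
    rw [hFP x.2] at h
    exact Subtype.ext (Submodule.disjoint_def.mp hdisj _ h x.2)
  · intro v
    obtain ⟨a, rfl⟩ := toStandard_surjective (U := U) e' α v
    have ha : e' α * a ∈ (rightProjective e' α).restrictScalars (SymmetricAlgebra ℂ U) :=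
      mul_mem_of_mem (Submodule.mem_span_singleton_self (e' α)) a
    rw [← hsup] at ha
    obtain ⟨k, hk, f, hf, hkf⟩ := Submodule.mem_sup.mp ha
    refine ⟨⟨f, hf⟩, ?_⟩
    rw [LinearMap.comp_apply, Submodule.subtype_apply, ← sub_eq_zero, ← map_sub,
      toStandard_eq_zero_iff, mul_sub, hFP hf, ← hkf, sub_add_cancel_right]
    exact neg_mem hk

omit [IsScalarTower ℂ (SymmetricAlgebra ℂ U) A'] [PartialOrder I] in
theorem map_mem_rightProjective (hdef : IsGradedDeformation U 𝒜 e 𝒜' e' π) {α : I} {x : A'}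
    (hx : x ∈ rightProjective e' α) : π x ∈ rightProjective e α := by
  obtain ⟨a, rfl⟩ := Submodule.mem_span_singleton.mp hx
  rw [MulOpposite.smul_eq_mul_unop, map_mul, hdef.map_idempotent]
  exact mul_mem_of_mem (Submodule.mem_span_singleton_self (e α)) _

/-- The map `V'_α → V_α` induced by `π`. -/
def standardMap (hdef : IsGradedDeformation U 𝒜 e 𝒜' e' π) (α : I) :
    RightStandard e' α →ₛₗ[RingHom.op (π : A' →+* A)] RightStandard e α :=
  Submodule.liftQ _
    { toFun := fun x : rightProjective e' α =>
        (Submodule.Quotient.mk ⟨π x, hdef.map_mem_rightProjective x.2⟩ : RightStandard e α)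
      map_add' := fun x y => by
        rw [← Submodule.Quotient.mk_add]
        exact congrArg Submodule.Quotient.mk (Subtype.ext (map_add π _ _))
      map_smul' := fun a x => by
        rw [← Submodule.Quotient.mk_smul]
        exact congrArg Submodule.Quotient.mk (Subtype.ext (map_mul π _ _)) }
    (fun x hx => (Submodule.Quotient.mk_eq_zero _).mpr (hdef.map_mem_rightTrace hx))

omit [IsScalarTower ℂ (SymmetricAlgebra ℂ U) A'] in
theorem standardMap_gen (hdef : IsGradedDeformation U 𝒜 e 𝒜' e' π) (α : I) :
    hdef.standardMap α (RightStandard.gen e' α) = RightStandard.gen e α :=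
  congrArg Submodule.Quotient.mk (Subtype.ext (hdef.map_idempotent α))

omit [IsScalarTower ℂ (SymmetricAlgebra ℂ U) A'] in
theorem standardMap_toStandard (hdef : IsGradedDeformation U 𝒜 e 𝒜' e' π) (α : I) (x : A') :
    hdef.standardMap α (toStandard U e' α x) =
      MulOpposite.op (π x) • RightStandard.gen e α := by
  rw [toStandard_apply, map_smulₛₗ, standardMap_gen]
  rfl

theorem standardMap_eq_zero_iff (hdef : IsGradedDeformation U 𝒜 e 𝒜' e' π) (α : I)
    (v : RightStandard e' α) :
    hdef.standardMap α v = 0 ↔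
      v ∈ augIdeal U • (⊤ : Submodule (SymmetricAlgebra ℂ U) (RightStandard e' α)) := by
  constructor
  · intro hv
    obtain ⟨x, rfl⟩ := toStandard_surjective (U := U) e' α v
    rw [standardMap_toStandard, RightStandard.op_smul_gen_eq_zero_iff] at hv
    obtain ⟨k, hk, hkx⟩ := hdef.exists_mem_rightTrace hv
    have h0 : π (e' α * x - k) = 0 := by
      rw [map_sub, map_mul, hdef.map_idempotent, hkx, sub_self]
    -- Subtracting the lift `k` of the trace part does not change the class, but moves the
    -- representative into `ker π = S_+ A'`.
    have h1 : toStandard U e' α x = toStandard U e' α (e' α * x - k) := by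
      rw [← sub_eq_zero, ← map_sub, toStandard_eq_zero_iff, mul_sub, mul_sub, ← mul_assoc,
        (hdef.idempotents.idem α).eq, sub_sub_cancel, (mem_rightProjective α
          (hdef.idempotents.idem α) k).mp (rightTrace_le_rightProjective α hk)]
      exact hk
    have h2 := Submodule.mem_map_of_mem (f := toStandard U e' α)
      ((hdef.map_eq_zero_iff_mem_smul _).mp h0)
    rw [Submodule.map_smul''] at h2
    rw [h1]
    exact Submodule.smul_mono le_rfl le_top h2
  · intro hv
    induction hv using Submodule.smul_induction_on' with
    | add x _ y _ hx hy => rw [map_add, hx, hy, add_zero]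
    | smul s hs w _ =>
      obtain ⟨x, rfl⟩ := toStandard_surjective (U := U) e' α w
      rw [← LinearMap.map_smul, standardMap_toStandard, hdef.map_smul, (mem_augIdeal_iff s).mp hs,
        zero_smul, MulOpposite.op_zero, zero_smul]

theorem isFlatDeformationOfStandard [GradedAlgebra 𝒜'] [FiniteDimensional ℂ U]
    [FiniteDimensional ℂ A]
    (hdef : IsGradedDeformation U 𝒜 e 𝒜' e' π) (hflat : Module.Flat (SymmetricAlgebra ℂ U) A')
    {α : I}
    (hα : HasFiltration ⊥ (rightTrace e α) (fun γ => α < γ) (fun γ => RightStandard e γ)) :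
    IsFlatDeformationOfStandard (U := U) e e' π α := by
  refine ⟨hdef.free_rightStandard hflat hα, hdef.standardMap α, hdef.standardMap_gen α, ?_,
    hdef.standardMap_eq_zero_iff α⟩
  intro v
  obtain ⟨a, rfl⟩ := RightStandard.exists_op_smul_gen α v
  obtain ⟨x, rfl⟩ := hdef.surjective a
  exact ⟨toStandard U e' α x, hdef.standardMap_toStandard α x⟩

/-! ### The central characters -/

/-- If `e_α A e_α ⊆ ℂ e_α + e_α A ε_α A`, the endomorphisms `e'_α A' e'_α` act on the generator of
`V'_α` by elements of `S`. -/
theorem exists_smul_gen [GradedAlgebra 𝒜'] (hdef : IsGradedDeformation U 𝒜 e 𝒜' e' π) {α : I}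
    (hα : ∀ a, ∃ c : ℂ, e α * a * e α - c • e α ∈ rightTrace e α) (x : A') :
    ∃ s : SymmetricAlgebra ℂ U,
      toStandard U e' α (e' α * x * e' α) = s • RightStandard.gen e' α := by
  let S := SymmetricAlgebra ℂ U
  have hidem := (hdef.idempotents.idem α).eq
  let H : Submodule S A' :=
    LinearMap.range (LinearMap.mulRight S (e' α) ∘ₗ LinearMap.mulLeft S (e' α))
  let K : Submodule S A' := (rightTrace e' α).restrictScalars S
  let Q : Submodule S A' := Submodule.span S {e' α} ⊔ K
  have hQ : HasComponents 𝒜' Q := by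
    intro y hy n
    obtain ⟨z, hz, k, hk, rfl⟩ := Submodule.mem_sup.mp hy
    rw [decompose_add]
    refine add_mem (Submodule.mem_sup_left (hasComponents_span hdef.parameter_mem ?_ z hz n))
      (Submodule.mem_sup_right (component_mem_rightTrace hdef.idempotent_mem hk n))
    rintro _ rfl
    exact ⟨0, hdef.idempotent_mem α⟩
  -- Nakayama for `H = e'_α A' e'_α` and `Q = S e'_α + e'_α A' ε'_α A'`: modulo `S_+ H` the
  -- inclusion is the hypothesis on `A`.
  have hle : H ≤ Q := by
    refine le_of_le_sup_augIdeal_smul hdef.parameter_mem hQ ?_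
    rintro _ ⟨y, rfl⟩
    change e' α * y * e' α ∈ _
    obtain ⟨c, hc⟩ := hα (π y)
    obtain ⟨k, hk, hkπ⟩ := hdef.exists_mem_rightTrace hc
    have hke : e' α * k = k := (mem_rightProjective α hidem k).mp
      (rightTrace_le_rightProjective α hk)
    have hz : π (e' α * y * e' α - c • e' α - k) = 0 := by
      simp [hdef.map_idempotent, hkπ]
    have h := mulLeft_mulRight_mem_augIdeal_smul (e' α) (e' α) (K := H)
      (fun y _ => ⟨y, rfl⟩) ((hdef.map_eq_zero_iff_mem_smul _).mp hz)
    -- Multiplying by `e'_α` on both sides makes the error term, an element of `ker π`, an element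
    -- of `S_+ H` rather than merely of `S_+ A'`.
    have hdecomp : e' α * y * e' α = (c • e' α + k * e' α) +
        e' α * (e' α * y * e' α - c • e' α - k) * e' α := by
      simp only [mul_sub, sub_mul, mul_smul_comm, smul_mul_assoc, hidem, hke]
      rw [← mul_assoc, ← mul_assoc, hidem, mul_assoc _ (e' α) (e' α), hidem]
      abel
    rw [hdecomp]
    refine add_mem (Submodule.mem_sup_left (add_mem (Submodule.mem_sup_left ?_)
      (Submodule.mem_sup_right (mul_mem_of_mem (K := rightTrace e' α) hk _))))
      (Submodule.mem_sup_right h)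
    rw [← algebraMap_smul S c (e' α)]
    exact Submodule.smul_mem _ _ (Submodule.mem_span_singleton_self _)
  obtain ⟨z, hz, k, hk, hzk⟩ := Submodule.mem_sup.mp (hle ⟨x, rfl⟩ : e' α * x * e' α ∈ Q)
  obtain ⟨s, rfl⟩ := Submodule.mem_span_singleton.mp hz
  refine ⟨s, ?_⟩
  have hgen : toStandard U e' α (e' α) = RightStandard.gen e' α := by
    rw [← sub_eq_zero, toStandard_apply, ← one_smul A'ᵐᵒᵖ (RightStandard.gen e' α), smul_smul,
      mul_one, ← sub_smul, ← MulOpposite.op_one, ← MulOpposite.op_sub,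
      RightStandard.op_smul_gen_eq_zero_iff, mul_sub, hidem, mul_one, sub_self]
    exact zero_mem _
  have hk0 : toStandard U e' α k = 0 := by
    rw [toStandard_eq_zero_iff, (mem_rightProjective α hidem k).mp
      (rightTrace_le_rightProjective α hk)]
    exact hk
  rw [← hzk, map_add, hk0, add_zero, LinearMap.map_smul, hgen]

end IsGradedDeformation

/-! ### The center -/

section Center

variable {U : Type*} [AddCommGroup U] [Module ℂ U]
  {A' : Type*} [Ring A'] [Algebra ℂ A'] [Algebra (SymmetricAlgebra ℂ U) A']
  [IsScalarTower ℂ (SymmetricAlgebra ℂ U) A'] {𝒜' : ℕ → Submodule ℂ A'} [GradedAlgebra 𝒜']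

-- It suffices to commute with a homogeneous `a` of degree `i`; compare the components of `a z = z
-- a` in degree `n + i`.
omit [IsScalarTower ℂ (SymmetricAlgebra ℂ U) A'] in
theorem component_mem_center {z : A'} (hz : z ∈ Subalgebra.center (SymmetricAlgebra ℂ U) A')
    (n : ℕ) : (decompose 𝒜' z n : A') ∈ Subalgebra.center (SymmetricAlgebra ℂ U) A' := by
  rw [Subalgebra.mem_center_iff] at hz ⊢
  intro a
  induction a using Decomposition.inductionOn 𝒜' with
  | zero => simp
  | @homogeneous i a =>
    have h := congrArg (fun y => (decompose 𝒜' y (n + i) : A')) (hz a)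
    simp only at h
    rwa [coe_decompose_mul_add_of_right_mem 𝒜' a.2, add_comm,
      coe_decompose_mul_add_of_left_mem 𝒜' a.2] at h
  | add a b ha hb => rw [add_mul, mul_add, ha, hb]

/-- A sum of homogeneous central elements has them as its components in `A'`, so independence of the
graded pieces of the center is inherited from `A'`. -/
theorem coe_decompose_coeAddMonoidHom_center (x : ⨁ n, centerGrading (U := U) 𝒜' n) (n : ℕ) :
    (decompose 𝒜' (DirectSum.coeAddMonoidHom (centerGrading (U := U) 𝒜') x : A') n : A') =
      ((x n : Subalgebra.center (SymmetricAlgebra ℂ U) A') : A') := by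
  induction x using DirectSum.induction_on with
  | zero => simp
  | of i x =>
    have hx : ((x : Subalgebra.center (SymmetricAlgebra ℂ U) A') : A') ∈ 𝒜' i := x.2
    rw [DirectSum.coeAddMonoidHom_of]
    by_cases h : i = n
    · subst h
      rw [decompose_of_mem_same 𝒜' hx, DirectSum.of_eq_same]
    · rw [decompose_of_mem_ne 𝒜' hx h, DirectSum.of_eq_of_ne _ _ _ (Ne.symm h)]
      rfl
  | add x y hx hy =>
    rw [map_add, Subalgebra.coe_add, decompose_add, DirectSum.add_apply, DirectSum.add_apply]
    push_cast
    rw [hx, hy]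

theorem isInternal_centerGrading : DirectSum.IsInternal (centerGrading (U := U) 𝒜') := by
  classical
  constructor
  · rw [injective_iff_map_eq_zero]
    intro x hx
    refine DFinsupp.ext fun n => Subtype.ext (Subtype.ext ?_)
    rw [← coe_decompose_coeAddMonoidHom_center, hx]
    simp
  · intro z
    let c (n : ℕ) : centerGrading (U := U) 𝒜' n :=
      ⟨⟨decompose 𝒜' (z : A') n, component_mem_center z.2 n⟩, (decompose 𝒜' (z : A') n).2⟩
    refine ⟨∑ n ∈ (decompose 𝒜' (z : A')).support, DirectSum.of _ n (c n), ?_⟩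
    rw [map_sum]
    simp only [DirectSum.coeAddMonoidHom_of]
    refine Subtype.ext ?_
    rw [AddSubmonoidClass.coe_finsetSum]
    exact sum_support_decompose 𝒜' (z : A')

theorem nonempty_gradedAlgebra_centerGrading :
    Nonempty (GradedAlgebra (centerGrading (U := U) 𝒜')) :=
  ⟨{ isInternal_centerGrading.chooseDecomposition with
    one_mem := SetLike.GradedOne.one_mem (A := 𝒜')
    mul_mem := fun _ _ _ _ hx hy => SetLike.GradedMul.mul_mem (A := 𝒜') hx hy }⟩

end Center

/-! ### The degree zero part of a quadratic algebra -/

namespace QuadraticRelations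

open BimoduleTensorAlgebra

variable {I : Type*} {M : Type*} [AddCommGroup M] [Module ℂ M]
  [Module (VertexRing I) M] [Module (VertexRing I)ᵐᵒᵖ M] (W : QuadraticRelations I M)

/-- The projection of `A` onto the coordinate of index `α` of its degree zero part. -/
def vertexCharacter (α : I) : W.QAlgebra →ₐ[ℂ] ℂ :=
  RingQuot.liftAlgHom ℂ ⟨lift (Pi.evalAlgHom ℂ (fun _ : I => ℂ) α) 0 (by simp) (by simp),
    fun x y h => by
      obtain ⟨hx, rfl⟩ := h
      have h2 := W.le_two hx
      clear hx
      rw [pow_two] at h2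
      rw [map_zero]
      induction h2 using Submodule.mul_induction_on' with
      | mem_mul_mem a ha b hb =>
        obtain ⟨m, rfl⟩ := ha
        rw [map_mul, lift_ofM, LinearMap.zero_apply, zero_mul]
      | add a _ b _ iha ihb => rw [map_add, iha, ihb, add_zero]⟩

theorem vertexCharacter_proj_ofR (α : I) (r : VertexRing I) :
    W.vertexCharacter α (W.proj (ofR I M r)) = r α := by
  simp [vertexCharacter, proj, lift_ofR]

theorem iSup_grading : ⨆ n, W.grading n = ⊤ :=
  (Decomposition.isInternal W.grading).submodule_iSup_eq_top

variable [DecidableEq I]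

theorem vertexCharacter_e (α β : I) :
    W.vertexCharacter α (W.e β) = if α = β then 1 else 0 := by
  rw [e, vertexCharacter_proj_ofR, Pi.single_apply]

theorem e_mem (α : I) : W.e α ∈ W.grading 0 := W.mk_ofR_mem _

theorem proj_ofR_mul_e (r : VertexRing I) (α : I) :
    W.proj (ofR I M r) * W.e α = r α • W.e α := by
  rw [e, ← map_mul, ← map_mul, ← map_smul, ← map_smul]
  congr 2
  ext β
  by_cases h : β = α
  · subst h; simp
  · simp [h]

theorem exists_mul_e_eq_smul (α : I) (a : W.QAlgebra) (ha : a ∈ W.grading 0) :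
    ∃ c : ℂ, a * W.e α = c • W.e α := by
  obtain ⟨r, rfl⟩ := ha
  exact ⟨r α, W.proj_ofR_mul_e r α⟩

theorem e_mul_mem (α : I) {n : ℕ} {a : W.QAlgebra} (ha : a ∈ W.grading n) :
    W.e α * a ∈ W.grading n := by
  simpa using SetLike.mul_mem_graded (W.e_mem α) ha

variable [PartialOrder I] [Fintype I]

/-- The character of `A` at the vertex `α` kills every other idempotent, hence `ε_α` and the trace,
but takes the value `1` on `e_α`. This makes the generators of `V_α` and of `V'_α` nonzero. -/
theorem e_notMem_rightTrace (α : I) : W.e α ∉ rightTrace W.e α := by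
  classical
  have hε : W.vertexCharacter α (eps W.e α) = 0 := by
    rw [eps, map_sum]
    refine Finset.sum_eq_zero fun β hβ => ?_
    rw [vertexCharacter_e, if_neg]
    rintro rfl
    simp at hβ
  have h0 : ∀ x ∈ rightTrace W.e α, W.vertexCharacter α x = 0 := by
    intro x hx
    induction hx using Submodule.span_induction with
    | mem x hx =>
      obtain ⟨a, rfl⟩ := hx
      simp only
      rw [map_mul, hε, mul_zero]
    | zero => exact map_zero _
    | add x y _ _ hx hy => rw [map_add, hx, hy, add_zero]
    | smul a x _ hx => rw [MulOpposite.smul_eq_mul_unop, map_mul, hx, zero_mul]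
  intro h
  simpa [vertexCharacter_e] using h0 _ h

end QuadraticRelations

/-! ### Endomorphisms of the generators of standard modules -/

section SimpleIdeal

variable {I : Type*} [PartialOrder I] {A : Type*} [Ring A] [Algebra ℂ A]
  {𝒜 : ℕ → Submodule ℂ A} {e : I → A}

omit [PartialOrder I] in
theorem mem_simpleIdeal_of_pos {n : ℕ} (hn : 0 < n) {a : A} (ha : a ∈ 𝒜 n) (α : I) :
    a ∈ simpleIdeal 𝒜 e α :=
  Submodule.subset_span (Or.inl ⟨n, hn, ha⟩)

omit [PartialOrder I] in
theorem e_mem_simpleIdeal {α β : I} (h : β ≠ α) : e β ∈ simpleIdeal 𝒜 e α :=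
  Submodule.subset_span (Or.inr ⟨β, h, rfl⟩)

-- This says that `e_α` acts by zero on `L_β`: in degree zero `a e_α` is a multiple of `e_α`, and in
-- positive degree it lies in `A_+ A`.
omit [PartialOrder I] in
theorem mul_mem_simpleIdeal (htop : ⨆ n, 𝒜 n = ⊤)
    (hzero : ∀ α, ∀ a ∈ 𝒜 0, ∃ c : ℂ, a * e α = c • e α) {α β : I} (h : α ≠ β) (a : A) :
    a * e α ∈ simpleIdeal 𝒜 e β := by
  have ha : a ∈ ⨆ n, 𝒜 n := htop ▸ Submodule.mem_top
  induction ha using Submodule.iSup_induction' with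
  | zero => simp
  | mem n a ha =>
    cases n with
    | zero =>
      obtain ⟨c, hc⟩ := hzero α a ha
      rw [hc, ← mul_one (e α), ← mul_smul_comm]
      exact mul_mem_of_mem (e_mem_simpleIdeal h) _
    | succ n => exact mul_mem_of_mem (mem_simpleIdeal_of_pos n.succ_pos ha β) _
  | add a b _ _ ha hb =>
    rw [add_mul]
    exact add_mem ha hb

omit [PartialOrder I] in
theorem exists_sub_smul_mem_simpleIdeal (htop : ⨆ n, 𝒜 n = ⊤)
    (hzero : ∀ α, ∀ a ∈ 𝒜 0, ∃ c : ℂ, a * e α = c • e α)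
    (hmul : ∀ α n, ∀ a ∈ 𝒜 n, e α * a ∈ 𝒜 n) {α : I} (hidem : IsIdempotentElem (e α)) (a : A) :
    ∃ c : ℂ, e α * a * e α - c • e α ∈ simpleIdeal 𝒜 e α := by
  have ha : a ∈ ⨆ n, 𝒜 n := htop ▸ Submodule.mem_top
  induction ha using Submodule.iSup_induction' with
  | zero => exact ⟨0, by simp⟩
  | mem n a ha =>
    cases n with
    | zero =>
      obtain ⟨c, hc⟩ := hzero α a ha
      refine ⟨c, ?_⟩
      rw [mul_assoc, hc, mul_smul_comm, hidem.eq, sub_self]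
      exact zero_mem _
    | succ n =>
      refine ⟨0, ?_⟩
      rw [zero_smul, sub_zero]
      exact mul_mem_of_mem
        (mem_simpleIdeal_of_pos n.succ_pos (hmul α _ a ha) α) _
  | add a b _ _ ha hb =>
    obtain ⟨c, hc⟩ := ha
    obtain ⟨d, hd⟩ := hb
    refine ⟨c + d, ?_⟩
    convert add_mem hc hd using 1
    rw [mul_add, add_mul, add_smul]
    abel

/-- In a quasi-hereditary algebra, `e_α A e_α ⊆ ℂ e_α + e_α A ε_α A`. -/
theorem exists_sub_smul_mem_rightTrace [Fintype I] (htop : ⨆ n, 𝒜 n = ⊤)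
    (hzero : ∀ α, ∀ a ∈ 𝒜 0, ∃ c : ℂ, a * e α = c • e α)
    (hmul : ∀ α n, ∀ a ∈ 𝒜 n, e α * a ∈ 𝒜 n) {α : I} (hidem : IsIdempotentElem (e α))
    (hα : HasFiltration (rightTrace e α) (rightProjective e α ⊓ simpleIdeal 𝒜 e α)
      (fun β => β < α) (fun β => RightSimple 𝒜 e β)) (a : A) :
    ∃ c : ℂ, e α * a * e α - c • e α ∈ rightTrace e α := by
  obtain ⟨n, F, hF0, hFn, hF⟩ := hα
  -- An element with `x = x e_α` descends the filtration: its class in a subquotient `L_β`, `β < α`,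
  -- is fixed by `e_α`, which acts there by zero.
  have key : ∀ i ≤ n, ∀ x ∈ F i, x * e α = x → x ∈ rightTrace e α := by
    intro i
    induction i with
    | zero => intro _ x hx _; exact hF0 ▸ hx
    | succ i ih =>
      intro hi x hx hxe
      obtain ⟨hle, β, hβ, ⟨φ⟩⟩ := hF i (by omega)
      refine ih (by omega) x ?_ hxe
      have h0 : φ (Submodule.Quotient.mk ⟨x, hx⟩) = 0 := by
        obtain ⟨y, hy⟩ := Submodule.Quotient.mk_surjective _ (φ (Submodule.Quotient.mk ⟨x, hx⟩))
        have hx' : (⟨x, hx⟩ : F (i + 1)) = MulOpposite.op (e α) • ⟨x, hx⟩ :=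
          Subtype.ext hxe.symm
        rw [hx', Submodule.Quotient.mk_smul, map_smul, ← hy, ← Submodule.Quotient.mk_smul,
          Submodule.Quotient.mk_eq_zero]
        exact mul_mem_simpleIdeal htop hzero hβ.ne' y
      rw [φ.map_eq_zero_iff, Submodule.Quotient.mk_eq_zero] at h0
      exact h0
  obtain ⟨c, hc⟩ := exists_sub_smul_mem_simpleIdeal htop hzero hmul hidem a
  refine ⟨c, key n le_rfl _ (hFn ▸ ⟨?_, hc⟩) ?_⟩
  · change _ ∈ rightProjective e α
    rw [mem_rightProjective α hidem, mul_sub, mul_smul_comm, ← mul_assoc, ← mul_assoc,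
      hidem.eq]
  · rw [sub_mul, smul_mul_assoc, mul_assoc _ (e α), hidem.eq]

end SimpleIdeal

/-! ### Central characters -/

/-- Over the domain `S` a nonzero vector `g` of a free module determines its scalars, so `ζ ↦ s`
inherits additivity, linearity and multiplicativity from the action on `g`. Centrality of `ζ`
carries the formula from `g` to all of `g A'`. -/
theorem exists_centralCharacter {U : Type*} [AddCommGroup U] [Module ℂ U]
    {A' : Type*} [Ring A'] [Algebra (SymmetricAlgebra ℂ U) A']
    {N : Type*} [AddCommGroup N] [Module A'ᵐᵒᵖ N] [Module (SymmetricAlgebra ℂ U) N]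
    [IsScalarTower (SymmetricAlgebra ℂ U) A'ᵐᵒᵖ N]
    [Module.Free (SymmetricAlgebra ℂ U) N] {g : N} (hg : g ≠ 0)
    (hgen : ∀ v : N, ∃ a : A', v = MulOpposite.op a • g)
    (hs : ∀ ζ : Subalgebra.center (SymmetricAlgebra ℂ U) A',
      ∃ s : SymmetricAlgebra ℂ U, MulOpposite.op (ζ : A') • g = s • g) :
    ∃ h : Subalgebra.center (SymmetricAlgebra ℂ U) A' →ₐ[SymmetricAlgebra ℂ U]
        SymmetricAlgebra ℂ U,
      ∀ (v : N) (ζ : Subalgebra.center (SymmetricAlgebra ℂ U) A'),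
        MulOpposite.op (ζ : A') • v = h ζ • v := by
  choose f hf using hs
  have hinj : Function.Injective fun s : SymmetricAlgebra ℂ U => s • g := smul_left_injective _ hg
  have hcomm (s : SymmetricAlgebra ℂ U) (a : A'ᵐᵒᵖ) (v : N) : a • s • v = s • a • v := by
    rw [← algebraMap_smul A'ᵐᵒᵖ s v, ← algebraMap_smul A'ᵐᵒᵖ s (a • v), smul_smul, smul_smul,
      Algebra.commutes]
  refine ⟨AlgHom.ofLinearMap
    { toFun := f
      map_add' := fun ζ ξ => hinj ?_
      map_smul' := fun s ζ => hinj ?_ } (hinj ?_) (fun ζ ξ => hinj ?_), ?_⟩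
  · simp only
    rw [add_smul, ← hf, ← hf, ← hf, Subalgebra.coe_add, MulOpposite.op_add, add_smul]
  · simp only
    rw [← hf, RingHom.id_apply, smul_eq_mul, mul_smul, ← hf, Subalgebra.coe_smul,
      MulOpposite.op_smul, smul_assoc]
  · simp only [LinearMap.coe_mk, AddHom.coe_mk]
    rw [← hf, Subalgebra.coe_one, MulOpposite.op_one, one_smul, one_smul]
  · simp only [LinearMap.coe_mk, AddHom.coe_mk]
    rw [← hf, Subalgebra.coe_mul, MulOpposite.op_mul, mul_smul, hf, hcomm, hf, smul_smul, mul_comm]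
  · intro v ζ
    obtain ⟨a, rfl⟩ := hgen v
    change _ = f ζ • _
    rw [← hcomm, ← hf, smul_smul, smul_smul, ← MulOpposite.op_mul, ← MulOpposite.op_mul,
      Subalgebra.mem_center_iff.mp ζ.2 a]

end StdKoszul

theorem mainTheorem3
    -- the finite poset, the bimodule of generators, and the quadratic algebra it defines
    {I : Type*} [Fintype I] [DecidableEq I] [PartialOrder I]
    {M : Type*} [AddCommGroup M] [Module ℂ M] [FiniteDimensional ℂ M]
    [Module (VertexRing I) M] [Module (VertexRing I)ᵐᵒᵖ M]
    [SMulCommClass (VertexRing I) (VertexRing I)ᵐᵒᵖ M]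
    [IsScalarTower ℂ (VertexRing I) M] [IsScalarTower ℂ (VertexRing I)ᵐᵒᵖ M]
    (W : QuadraticRelations I M) (hA : IsStandardKoszul W.grading W.e)
    -- a flat graded deformation over `S = Sym U`
    {U : Type*} [AddCommGroup U] [Module ℂ U] [FiniteDimensional ℂ U]
    {A' : Type*} [Ring A'] [Algebra ℂ A'] [Algebra (SymmetricAlgebra ℂ U) A']
    [IsScalarTower ℂ (SymmetricAlgebra ℂ U) A']
    (𝒜' : ℕ → Submodule ℂ A') [GradedAlgebra 𝒜'] (e' : I → A') (π : A' →ₐ[ℂ] W.QAlgebra)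
    (hdef : IsGradedDeformation U W.grading W.e 𝒜' e' π)
    (hflat : Module.Flat (SymmetricAlgebra ℂ U) A') :
    (∀ α, IsFlatDeformationOfStandard (U := U) W.e e' π α) ∧
    ∃ h : I → (Subalgebra.center (SymmetricAlgebra ℂ U) A' →ₐ[SymmetricAlgebra ℂ U]
        SymmetricAlgebra ℂ U),
      IsCentralCharacter e' h ∧ (∀ h', IsCentralCharacter e' h' → h' = h) ∧
      IsLocalizationAlgebra U (centerGrading 𝒜') I
        (AlgHom.pi h) := by
  have hidem (α : I) : IsIdempotentElem (W.e α) := hdef.orthogonalIdempotents.idem α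
  have := hA.finiteDimensional
  have hfree (α : I) : Module.Free (SymmetricAlgebra ℂ U) (RightStandard e' α) :=
    hdef.free_rightStandard hflat (hA.quasiHereditary.ker_projective_standard α)
  -- The generator of `V'_α` maps to that of `V_α`, which is nonzero because `e_α` is not in the
  -- trace.
  have hgen (α : I) : RightStandard.gen e' α ≠ 0 := by
    intro h
    have h1 := hdef.standardMap_gen α
    rw [h, map_zero, ← one_smul (W.QAlgebra)ᵐᵒᵖ (RightStandard.gen W.e α), eq_comm,
      ← MulOpposite.op_one, RightStandard.op_smul_gen_eq_zero_iff, mul_one] at h1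
    exact W.e_notMem_rightTrace α h1
  have hact (α : I) (ζ : Subalgebra.center (SymmetricAlgebra ℂ U) A') :
      ∃ s : SymmetricAlgebra ℂ U,
        MulOpposite.op (ζ : A') • RightStandard.gen e' α = s • RightStandard.gen e' α := by
    obtain ⟨s, hs⟩ := hdef.exists_smul_gen (exists_sub_smul_mem_rightTrace
      W.iSup_grading W.exists_mul_e_eq_smul (fun β _ _ => W.e_mul_mem β) (hidem α)
      (hA.quasiHereditary.ker_standard_simple α)) (ζ : A')
    refine ⟨s, hs ▸ ?_⟩
    have hα := (hdef.idempotents.idem α).eq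
    have hζ := Subalgebra.mem_center_iff.mp ζ.2 (e' α)
    -- Since `ζ` is central, `ζ` and `e'_α ζ e'_α` have the same product with `e'_α`, hence the same
    -- effect on the generator.
    rw [← toStandard_apply (U := U), ← sub_eq_zero, ← map_sub, toStandard_eq_zero_iff, mul_sub, hζ,
      mul_assoc (ζ : A'), hα, ← mul_assoc (e' α), hζ, mul_assoc (ζ : A'), hα, sub_self]
    exact zero_mem _
  have hchar (α : I) :=
    exists_centralCharacter (hgen α) (RightStandard.exists_op_smul_gen α) (hact α)
  choose h hh using hchar
  refine ⟨fun α => hdef.isFlatDeformationOfStandard hflat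
    (hA.quasiHereditary.ker_projective_standard α), h, hh, fun h' hh' => ?_, ?_⟩
  · funext α
    have := hfree α
    refine AlgHom.ext fun ζ => smul_left_injective _ (hgen α) ?_
    exact (hh' α _ ζ).symm.trans (hh α _ ζ)
  · have := hdef.moduleFinite
    -- The center is an `S`-submodule of a finite module over a noetherian ring, so it is even
    -- module-finite.
    have : Module.Finite (SymmetricAlgebra ℂ U) (Subalgebra.center (SymmetricAlgebra ℂ U) A') :=
      Module.Finite.of_injective (Subalgebra.center (SymmetricAlgebra ℂ U) A').val.toLinearMap
        Subtype.val_injective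
    exact ⟨inferInstance, inferInstance, nonempty_gradedAlgebra_centerGrading,
      hdef.parameter_mem, inferInstance⟩
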